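/- **Setting.** Let $\mathbf F_q$ be a finite field, $K_\infty=\mathbf F_q((\theta^{-1}))$, $\mathbf C_\infty$ the completion of an algebraic closure of $K_\infty$, $K\subset K_\infty$ a field containing $\mathbf F_q(\theta)$ and of finite degree over it, $O_K$ the integral closure of $\mathbf F_q[\theta]$ in $K$, $K^{\rm sep}$ a separable closure of $K$. Let $A=\mathbf F_q[t]$, $F=\mathbf F_q(t)$, $F_\infty=\mathbf F_q((1/t))$, and let $i\colon A\to O_K$ be the $\mathbf F_q$-algebra map with $i(t)=\theta$. For a non-zero prime $\lambda$ of $A$ let $A_\lambda$ be the $\lambda$-adic completion of $A$ and $F_\lambda=A_\lambda\otimes_A F$. A *$\sigma$-module* of rank $r$ over an $\mathbf F_q$-algebra $R$ is a finitely generated projective $R\otimes_{\mathbf F_q}A=R[t]$-module $M$ of constant rank $r$ with an $A$-linear map $\sigma\colon M\to M$ such that $\sigma(xm)=x^q\sigma(m)$ for $x\in R$. Over a field it is *non-degenerate* if $\det\sigma\neq0$ on $\det M=\bigwedge^r M$; over $R$, if $M_L$ is non-degenerate for all fields $R\to L$. An *effective $t$-motive* over $K$ is a non-degenerate $\sigma$-module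 $M$ over $K$ with $\det M\cong(K[t]e,\ e\mapsto\alpha(t-\theta)^ne)$ for some $\alpha\in K^\times$, $n\ge0$. Write $R[\tau]$ for the ring of twisted polynomials, with $\tau$ acting as $\sigma$ on $\sigma$-modules over $R$ and as the $q$-th power map on $R$-algebras. Let $M$ be an effective $t$-motive over $K$, finitely generated over $K[\tau]$, with associated abelian $t$-module $E$: for a $K$-algebra $R$, $E(R)=\mathrm{Hom}_{K[\tau]}(M,R)$ and $\mathrm{Lie}_E(R)=\mathrm{Hom}_K(M/K\sigma(M),R)$, with $A$ acting through $M$. Let $\exp_E\colon\mathrm{Lie}_E(\mathbf C_\infty)\to E(\mathbf C_\infty)$ be the unique entire $A$-module homomorphism tangent to the identity. $M$ is *uniformizable* if $\exp_E$ is surjective. $M$ has *everywhere good reduction* if there is a *good model*: a non-degenerate $\sigma$-module $\mathcal M$ over $O_K$ with an isomorphism $\mathcal M_K\cong M$. Given one (it is unique up to unique isomorphism), let $E(O_K)\subset E(K)$ and $\mathrm{Lie}_E(O_K)\subset\mathrm{Lie}_E(K)$ be the images of $\mathrm{Hom}_{O_K[\tau]}(\mathcal M,O_K)$ and $\mathrm{Hom}_{O_K}(\mathcal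 M/O_K\sigma(\mathcal M),O_K)$. Put $W_E=\mathrm{Lie}_E/(t-\theta)\mathrm{Lie}_E$ with projection $w\colon\mathrm{Lie}_E\to W_E$, and $W_E(O_K)=w(\mathrm{Lie}_E(O_K))$. On $W_E(K_\infty)$ the structures of $F_\infty$- and of $K_\infty$-vector space coincide under $t=\theta$. Let $V_\lambda(M)=F_\lambda\otimes_{A_\lambda}\varprojlim_n(M_{K^{\rm sep}}/\lambda^nM_{K^{\rm sep}})^{\sigma=1}$ with its action of $\mathrm{Gal}(K^{\rm sep}/K)$, and let $\rho_\lambda$ be the dual representation $V_\lambda(M)^\vee=V_\lambda(M^\vee)$. For a finite place $v$ of $K$ let $P_v(X)\in F[X]$ be $\det(1-X\rho_\lambda(\mathrm{Frob}_v))$, with $\mathrm{Frob}_v$ a geometric Frobenius element, for all $\lambda$ with $i(\lambda)$ coprime to $v$, and let $L(E,0)=L(M^\vee,0)=\prod_v P_v(1)^{-1}\in F_\infty$, the product being over all finite places $v$ of $K$. **The conjecture** for a uniformizable such $M$ with everywhere good reduction: there is a sub-$A$-module $Z\subset\mathrm{Lie}_E(K_\infty)$ of rank $d=\dim W_E$ such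 that $\exp_E(Z)\subset E(O_K)$ and $$\bigwedge\nolimits^{d}_A w(Z)=L(E,0)\cdot\bigwedge\nolimits^{d}_A W_E(O_K)$$ as $A$-submodules of $\bigwedge^{d}_{K_\infty}W_E(K_\infty)$ (both sides denoting the images there of the exterior powers). **Proposition.** Let $M_1$ and $M_2$ be effective $t$-motives over $K$ that are finitely generated over $K[\tau]$, uniformizable and with everywhere good reduction. If the conjecture holds for $M_1$ and for $M_2$, then $M_1\oplus M_2$ is also an effective $t$-motive that is finitely generated over $K[\tau]$, uniformizable and with everywhere good reduction, and the conjecture holds for $M_1\oplus M_2$. -/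

import Mathlib

open scoped TensorProduct
open Polynomial

universe u v w

attribute [local instance] Polynomial.algebra

noncomputable section

namespace TMotive

/-! ## The base fields

Throughout `k` is a finite field with `q` elements. -/

section BaseFields

variable (k : Type u) [Field k]

/-- `K_∞ = 𝔽_q((θ⁻¹))`; the variable of the Laurent series is `θ⁻¹`. -/
def Kinf : Type u := LaurentSeries k

/-- The rank one structure normalising the valuation of `𝔽_q((θ⁻¹))` to `|θ| = q`. -/
instance laurentRankOne [Fintype k] :
    (Valued.v : Valuation (LaurentSeries k) (WithZero (Multiplicative ℤ))).RankOne where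
  hom' := (WithZeroMulInt.toNNReal
      (show ((Fintype.card k : ℕ) : NNReal) ≠ 0 from by
        exact_mod_cast Fintype.card_ne_zero)).comp MonoidWithZeroHom.ValueGroup₀.embedding
  strictMono' := by
    refine (WithZeroMulInt.toNNReal_strictMono ?_).comp
      MonoidWithZeroHom.ValueGroup₀.embedding_strictMono
    exact_mod_cast Fintype.one_lt_card
  exists_val_nontrivial := by
    obtain ⟨x, hx⟩ := LaurentSeries.valuation_surjective k (WithZero.exp (1 : ℤ))
    exact ⟨x, by rw [hx]; simp, by rw [hx]; simp⟩

variable [Fintype k]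

/-- The absolute value of `K_∞`, induced by the `θ⁻¹`-adic valuation. -/
instance : NontriviallyNormedField (Kinf k) :=
  Valued.toNontriviallyNormedField (LaurentSeries k) (WithZero (Multiplicative ℤ))

instance : IsUltrametricDist (Kinf k) :=
  letI := Valued.toNontriviallyNormedField (LaurentSeries k) (WithZero (Multiplicative ℤ))
  inferInstanceAs (IsUltrametricDist (LaurentSeries k))

instance : CompleteSpace (Kinf k) :=
  inferInstanceAs (CompleteSpace (LaurentSeries k))

instance : Algebra k (Kinf k) := inferInstanceAs (Algebra k (LaurentSeries k))

/-- The element `θ` of `K_∞`. -/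
def theta : Kinf k := (HahnSeries.single (-1 : ℤ) (1 : k) : LaurentSeries k)

/-- An algebraic closure of `K_∞`, with the unique extension of the absolute value. -/
def KinfBar : Type u := AlgebraicClosure (Kinf k)

instance : NontriviallyNormedField (KinfBar k) :=
  spectralNorm.nontriviallyNormedField (Kinf k) (AlgebraicClosure (Kinf k))

instance : Algebra (Kinf k) (KinfBar k) :=
  inferInstanceAs (Algebra (Kinf k) (AlgebraicClosure (Kinf k)))

/-- `ℂ_∞`, the completion of an algebraic closure of `K_∞`. -/
def Cinf : Type u := UniformSpace.Completion (KinfBar k)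

instance : NormedField (Cinf k) :=
  inferInstanceAs (NormedField (UniformSpace.Completion (KinfBar k)))

/-- The embedding of `K_∞` in `ℂ_∞`. -/
def toCinf : Kinf k →+* Cinf k :=
  (UniformSpace.Completion.coeRingHom : KinfBar k →+* UniformSpace.Completion (KinfBar k)).comp
    (algebraMap (Kinf k) (KinfBar k))

instance : Algebra (Kinf k) (Cinf k) := (toCinf k).toAlgebra

/-- The rational function field `𝔽_q(θ)` inside `K_∞`. -/
abbrev ratTheta : IntermediateField k (Kinf k) := IntermediateField.adjoin k {theta k}

variable (K : IntermediateField (ratTheta k) (Kinf k))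

/-- The element `θ` of `K`. -/
def thetaK : K := algebraMap (ratTheta k) K
  ⟨theta k, IntermediateField.mem_adjoin_simple_self k (theta k)⟩

/-- `O_K`, the integral closure of `𝔽_q[θ]` in `K`. -/
def OK : Subalgebra k K :=
  (integralClosure (Algebra.adjoin k {thetaK k K}) K).restrictScalars k

/-- The element `θ` of `O_K`. -/
def thetaO : OK k K :=
  ⟨thetaK k K, isIntegral_algebraMap (R := Algebra.adjoin k {thetaK k K})
    (x := ⟨thetaK k K, Algebra.self_mem_adjoin_singleton k (thetaK k K)⟩)⟩

theorem transcendental_theta : Transcendental k (theta k) := by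
  have hX : Transcendental k (HahnSeries.single (1 : ℤ) (1 : k) : LaurentSeries k) := by
    rw [transcendental_iff_injective]
    have h := (faithfulSMul_iff_algebraMap_injective k[X] (LaurentSeries k)).mp inferInstance
    have e : ⇑(Polynomial.aeval (HahnSeries.single (1 : ℤ) (1 : k) : LaurentSeries k)) =
        (algebraMap k[X] (LaurentSeries k) : k[X] → LaurentSeries k) := by
      have e2 : ((Polynomial.aeval (HahnSeries.single (1 : ℤ) (1 : k) : LaurentSeries k) :
          k[X] →ₐ[k] LaurentSeries k) : k[X] →+* LaurentSeries k) =
          algebraMap k[X] (LaurentSeries k) := by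
        ext
        · simp only [RingHom.comp_apply, RingHom.coe_coe, Polynomial.aeval_C,
            HahnSeries.algebraMap_apply']
          simp [PowerSeries.algebraMap_apply']
        · simp [Polynomial.algebraMap_hahnSeries_apply]
      exact congrArg DFunLike.coe e2
    rw [e]
    exact h
  have hinv : (HahnSeries.single (-1 : ℤ) (1 : k) : LaurentSeries k) =
      (HahnSeries.single (1 : ℤ) (1 : k) : LaurentSeries k)⁻¹ := by
    simp
  have h2 : Transcendental k (HahnSeries.single (-1 : ℤ) (1 : k) : LaurentSeries k) := by
    rw [hinv]
    exact fun h => hX (IsAlgebraic.inv_iff.mp h)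
  exact h2

/-- The embedding of `F = 𝔽_q(t)` in `F_∞`; the field `F_∞ = 𝔽_q((t⁻¹))` is identified with
`K_∞` by `t = θ`. -/
def ratToKinf : RatFunc k →ₐ[k] Kinf k :=
  RatFunc.liftAlgHom (Polynomial.aeval (theta k))
    (nonZeroDivisors_le_comap_nonZeroDivisors_of_injective _
      (transcendental_iff_injective.mp (transcendental_theta k)))

end BaseFields

/-! ## `σ`-modules -/

section SigmaModules

variable (k : Type u) [Field k] [Fintype k]

/-- The endomorphism `x ⊗ a ↦ x^q ⊗ a` of `R ⊗ A = R[t]`. -/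
def frobX (R : Type v) [CommRing R] [Algebra k R] : R[X] →+* R[X] :=
  Polynomial.mapRingHom (FiniteField.frobeniusAlgHom k R : R →+* R)

/-- A `σ`-module over `R`, where `R ⊗ A = R[t]`: a projective module of constant finite rank with
a map `σ` that is `A`-linear and satisfies `σ (x m) = x^q σ m` for `x ∈ R`. -/
structure SigmaModule (R : Type v) [CommRing R] [Algebra k R] where
  carrier : Type w
  [addCommGroup : AddCommGroup carrier]
  [module : Module R[X] carrier]
  [finite : Module.Finite R[X] carrier]
  [projective : Module.Projective R[X] carrier]
  rank : ℕ
  rank_eq : ∀ p : PrimeSpectrum R[X], Module.rankAtStalk carrier p = rank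
  σ : carrier →ₛₗ[frobX k R] carrier

namespace SigmaModule

attribute [instance] SigmaModule.addCommGroup SigmaModule.module SigmaModule.finite
  SigmaModule.projective

variable {k} {R : Type v} [CommRing R] [Algebra k R]

/-- The direct sum of two `σ`-modules. -/
def prod (M N : SigmaModule.{u, v, w} k R) : SigmaModule.{u, v, w} k R where
  carrier := M.carrier × N.carrier
  rank := M.rank + N.rank
  rank_eq p := by
    rw [Module.rankAtStalk_prod, Pi.add_apply, M.rank_eq, N.rank_eq]
  σ :=
    { toFun := fun m => (M.σ m.1, N.σ m.2)
      map_add' := fun m n => by simp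
      map_smul' := fun a m => by ext <;> simp }

variable (M : SigmaModule.{u, v, w} k R)

/-- The action of `R` on a `σ`-module over `R`, through `R → R[t]`. -/
instance : Module R M.carrier := Module.compHom M.carrier (Polynomial.C : R →+* R[X])

/-- The action of `A = 𝔽_q[t]` on a `σ`-module over `R`, through `𝔽_q[t] → R[t]`. -/
instance : Module k[X] M.carrier :=
  Module.compHom M.carrier (Polynomial.mapRingHom (algebraMap k R))

theorem smul_def (r : R) (m : M.carrier) : r • m = (Polynomial.C r : R[X]) • m := rfl

theorem polynomial_smul_def (a : k[X]) (m : M.carrier) :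
    a • m = (a.map (algebraMap k R)) • m := rfl

instance : SMulCommClass k[X] R M.carrier :=
  ⟨fun a r m => by simp only [smul_def, polynomial_smul_def, smul_smul, mul_comm]⟩

theorem frobX_map (a : k[X]) :
    frobX k R (a.map (algebraMap k R)) = a.map (algebraMap k R) := by
  simp only [frobX, Polynomial.coe_mapRingHom, Polynomial.map_map]
  congr 1
  ext x
  simp

/-- The `A`-linear map underlying `σ`. -/
def sigmaA : M.carrier →ₗ[k[X]] M.carrier where
  toFun := M.σ
  map_add' := map_add M.σ
  map_smul' a m := by
    simp only [polynomial_smul_def, map_smulₛₗ, frobX_map, RingHom.id_apply]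

section BaseChange

variable (S : Type v) [CommRing S] [Algebra k S] [Algebra R S] [IsScalarTower k R S]

/-- The map `σ` on the first factor of `S[t] ⊗ M`. -/
def frobXSemilinear : S[X] →ₛₗ[frobX k R] S[X] where
  toFun := frobX k S
  map_add' := map_add _
  map_smul' a b := by
    rw [Algebra.smul_def, Algebra.smul_def, map_mul]
    congr 1
    simp only [Polynomial.algebraMap_def, frobX, Polynomial.coe_mapRingHom, Polynomial.map_map]
    congr 1
    ext x
    simp

/-- The extension of scalars `M_S = M ⊗_R S = S[t] ⊗_{R[t]} M`, with `σ (s ⊗ m) = s^q ⊗ σ m`. -/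
def baseChange : SigmaModule.{u, v, max v w} k S where
  carrier := S[X] ⊗[R[X]] M.carrier
  rank := M.rank
  rank_eq p := by
    rw [Module.rankAtStalk_baseChange, M.rank_eq]
  σ :=
    { toFun := TensorProduct.map (frobXSemilinear (k := k) (R := R) S) M.σ
      map_add' := map_add _
      map_smul' := fun a x => by
        induction x using TensorProduct.induction_on with
        | zero => simp
        | tmul b m =>
          rw [TensorProduct.smul_tmul', TensorProduct.map_tmul, TensorProduct.map_tmul,
            TensorProduct.smul_tmul']
          simp [frobXSemilinear]
        | add x y hx hy => simp only [smul_add, map_add, hx, hy] }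

/-- The canonical map `M → M_S`. -/
def toBaseChange (m : M.carrier) : (M.baseChange S).carrier := (1 : S[X]) ⊗ₜ[R[X]] m

end BaseChange

section Properties

/-- `det σ ≠ 0` on `det M`, where `det M` is the top exterior power and `det σ` sends
`m₁ ∧ ⋯ ∧ m_r` to `σ m₁ ∧ ⋯ ∧ σ m_r`. -/
def DetNonzero : Prop :=
  ∃ m : Fin M.rank → M.carrier,
    exteriorPower.ιMulti R[X] M.rank (fun i => M.σ (m i)) ≠ 0

/-- `M` is non-degenerate: `det σ ≠ 0` on `M_L` for every `R`-field `L`. -/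
def Nondegenerate : Prop :=
  ∀ (L : Type v) [Field L] [Algebra k L] [Algebra R L] [IsScalarTower k R L],
    (M.baseChange L).DetNonzero

/-- `M` is finitely generated as a left `R[τ]`-module, `τ` acting as `σ`. -/
def FiniteOverTau : Prop :=
  ∃ s : Finset M.carrier, ∀ N : Submodule R M.carrier,
    (∀ m ∈ s, m ∈ N) → (∀ m ∈ N, M.σ m ∈ N) → N = ⊤

end Properties

/-! ### The `t`-module `E_M` and its Lie algebra -/

section TModule

variable (S : Type*) [CommRing S] [Algebra R S]

/-- `E_M(S) = Hom_{R[τ]}(M, S)`, with `τ` acting on `S` as `s ↦ s^q`. -/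
def EPoints : AddSubgroup (M.carrier →ₗ[R] S) where
  carrier := {f | ∀ m, f (M.σ m) = f m ^ Fintype.card k}
  zero_mem' m := by simp [Fintype.card_ne_zero]
  add_mem' {f g} hf hg m := by
    let _ : Algebra k S := ((algebraMap R S).comp (algebraMap k R)).toAlgebra
    have h := map_add (FiniteField.frobeniusAlgHom k S) (f m) (g m)
    simp only [FiniteField.frobeniusAlgHom_apply] at h
    rw [LinearMap.add_apply, LinearMap.add_apply, h, hf m, hg m]
  neg_mem' {f} hf m := by
    let _ : Algebra k S := ((algebraMap R S).comp (algebraMap k R)).toAlgebra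
    have h := map_neg (FiniteField.frobeniusAlgHom k S) (f m)
    simp only [FiniteField.frobeniusAlgHom_apply] at h
    rw [LinearMap.neg_apply, LinearMap.neg_apply, h, hf m]

/-- The `R`-linear maps `M → S` that vanish on `σ(M)`. -/
def lieSubmodule : Submodule S (M.carrier →ₗ[R] S) where
  carrier := {ξ | ∀ m, ξ (M.σ m) = 0}
  zero_mem' m := by simp
  add_mem' {f g} hf hg m := by simp [hf m, hg m]
  smul_mem' c f hf m := by simp [hf m]

/-- `Lie_E(S) = Hom_R(M / R σ(M), S)`. -/
def LiePoints : Type _ := M.lieSubmodule S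

instance : AddCommGroup (M.LiePoints S) := inferInstanceAs (AddCommGroup (M.lieSubmodule S))

instance : Module S (M.LiePoints S) := inferInstanceAs (Module S (M.lieSubmodule S))

/-- Multiplication by `a ∈ A` on `M`, as an `R`-linear map. -/
def mulA (a : k[X]) : M.carrier →ₗ[R] M.carrier where
  toFun m := a • m
  map_add' := smul_add a
  map_smul' r m := smul_comm a r m

/-- `A` acts on `E_M(S)` through its action on `M`. -/
instance : Module k[X] (M.EPoints S) where
  smul a f := ⟨f.1 ∘ₗ M.mulA a, fun m => by
    have h := f.2 (a • m)
    rwa [show M.σ (a • m) = a • M.σ m from M.sigmaA.map_smul a m] at h⟩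
  one_smul f := Subtype.ext (LinearMap.ext fun m => congrArg f.1 (one_smul k[X] m))
  mul_smul a b f := Subtype.ext (LinearMap.ext fun m =>
    congrArg f.1 ((congrArg (· • m) (mul_comm a b)).trans (mul_smul b a m)))
  smul_zero a := rfl
  smul_add a f g := rfl
  add_smul a b f := Subtype.ext (LinearMap.ext fun m =>
    (congrArg f.1 (add_smul a b m)).trans (map_add f.1 _ _))
  zero_smul f := Subtype.ext (LinearMap.ext fun m =>
    (congrArg f.1 (zero_smul k[X] m)).trans (map_zero f.1))

/-- `A` acts on `Lie_E(S)` through its action on `M`. -/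
instance : Module k[X] (M.LiePoints S) where
  smul a f := ⟨f.1 ∘ₗ M.mulA a, fun m => by
    have h := f.2 (a • m)
    rwa [show M.σ (a • m) = a • M.σ m from M.sigmaA.map_smul a m] at h⟩
  one_smul f := Subtype.ext (LinearMap.ext fun m => congrArg f.1 (one_smul k[X] m))
  mul_smul a b f := Subtype.ext (LinearMap.ext fun m =>
    congrArg f.1 ((congrArg (· • m) (mul_comm a b)).trans (mul_smul b a m)))
  smul_zero a := rfl
  smul_add a f g := rfl
  add_smul a b f := Subtype.ext (LinearMap.ext fun m =>
    (congrArg f.1 (add_smul a b m)).trans (map_add f.1 _ _))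
  zero_smul f := Subtype.ext (LinearMap.ext fun m =>
    (congrArg f.1 (zero_smul k[X] m)).trans (map_zero f.1))

theorem lie_smul_apply (a : k[X]) (ξ : M.LiePoints S) (m : M.carrier) :
    (a • ξ).1 m = ξ.1 (a • m) := rfl

/-- `Lie_E(S)` is the tangent space at the identity: `ξ` lies in it if and only if `ε ξ` is a
point of `E_M(S[ε])`. -/
theorem mem_lieSubmodule_iff (ξ : M.carrier →ₗ[R] S) :
    ξ ∈ M.lieSubmodule S ↔
      (TrivSqZeroExt.inrHom S S).restrictScalars R ∘ₗ ξ ∈ M.EPoints (TrivSqZeroExt S S) := by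
  have hq : 2 ≤ Fintype.card k := Fintype.one_lt_card
  have hz (s : S) : (TrivSqZeroExt.inr s : TrivSqZeroExt S S) ^ Fintype.card k = 0 := by
    refine pow_eq_zero_of_le hq ?_
    rw [pow_two, TrivSqZeroExt.inr_mul_inr]
  refine forall_congr' fun m => ?_
  change ξ (M.σ m) = 0 ↔ (TrivSqZeroExt.inr (ξ (M.σ m)) : TrivSqZeroExt S S) =
    TrivSqZeroExt.inr (ξ m) ^ Fintype.card k
  rw [hz, ← TrivSqZeroExt.inr_zero S, TrivSqZeroExt.inr_injective.eq_iff]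

/-- The action of `t` on `Lie_E(S)`, as an `S`-linear map. -/
def tLie : M.LiePoints S →ₗ[S] M.LiePoints S where
  toFun ξ := (X : k[X]) • ξ
  map_add' := smul_add _
  map_smul' _ _ := rfl

/-- `W_E(S) = Lie_E(S) / (t - θ) Lie_E(S)`, with `θ` the image of `t` in `S`. -/
abbrev WPoints (θ : S) : Type _ :=
  M.LiePoints S ⧸ LinearMap.range (M.tLie S - θ • (LinearMap.id : M.LiePoints S →ₗ[S] M.LiePoints S))

variable {S}
variable {S' : Type*} [CommRing S'] [Algebra R S']

/-- Functoriality of `E_M(S)` in `S`. -/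
def EMap (φ : S →ₐ[R] S') (f : M.EPoints S) : M.EPoints S' :=
  ⟨φ.toLinearMap ∘ₗ f.1, fun m => by
    change φ (f.1 (M.σ m)) = φ (f.1 m) ^ _
    rw [f.2 m, map_pow]⟩

/-- Functoriality of `Lie_E(S)` in `S`. -/
def lieMap (φ : S →ₐ[R] S') (ξ : M.LiePoints S) : M.LiePoints S' :=
  ⟨φ.toLinearMap ∘ₗ ξ.1, fun m => by
    change φ (ξ.1 (M.σ m)) = 0
    rw [ξ.2 m, map_zero]⟩

end TModule

end SigmaModule
end SigmaModules

/-! ## Galois representations and the `L`-value -/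

section Galois

variable {k : Type u} [Field k] [Fintype k]

namespace SigmaModule

section Field

variable {K : Type v} [Field K] [Algebra k K] (M : SigmaModule.{u, v, w} k K)

/-- The absolute Galois group `Gal(K^sep / K)`. -/
abbrev GalK (K : Type v) [Field K] : Type v := SeparableClosure K ≃ₐ[K] SeparableClosure K

/-- `M_{K^sep}`. -/
abbrev sep : SigmaModule.{u, v, max v w} k (SeparableClosure K) :=
  M.baseChange (SeparableClosure K)

/-- The map on `K^sep[t]` induced by an automorphism of `K^sep` over `K`. -/
def galPoly (g : GalK K) : (SeparableClosure K)[X] →ₗ[K[X]] (SeparableClosure K)[X] where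
  toFun := Polynomial.map (g : SeparableClosure K →+* SeparableClosure K)
  map_add' _ _ := Polynomial.map_add _
  map_smul' a b := by
    rw [Algebra.smul_def, Polynomial.map_mul, RingHom.id_apply, Algebra.smul_def]
    congr 1
    simp only [Polynomial.algebraMap_def, Polynomial.coe_mapRingHom, Polynomial.map_map]
    congr 1
    ext x
    simp

theorem galPoly_map {k : Type u} [Field k] {K : Type v} [Field K] [Algebra k K] (g : GalK K) (a : k[X]) :
    galPoly g (a.map (algebraMap k (SeparableClosure K))) =
      a.map (algebraMap k (SeparableClosure K)) := by
  change Polynomial.map (g : SeparableClosure K →+* SeparableClosure K) _ = _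
  rw [Polynomial.map_map]
  congr 1
  ext x
  simp [IsScalarTower.algebraMap_apply k K (SeparableClosure K)]

theorem galPoly_mul (g : GalK K) (a b : (SeparableClosure K)[X]) :
    galPoly g (a * b) = galPoly g a * galPoly g b := Polynomial.map_mul _

theorem rTensor_galPoly_smul (g : GalK K) (a : k[X])
    (x : (SeparableClosure K)[X] ⊗[K[X]] M.carrier) :
    LinearMap.rTensor M.carrier (galPoly g) ((a.map (algebraMap k (SeparableClosure K))) • x) =
      (a.map (algebraMap k (SeparableClosure K))) • LinearMap.rTensor M.carrier (galPoly g) x := by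
  induction x using TensorProduct.induction_on with
  | zero => simp
  | tmul b m =>
    rw [TensorProduct.smul_tmul', LinearMap.rTensor_tmul, LinearMap.rTensor_tmul,
      TensorProduct.smul_tmul', smul_eq_mul, smul_eq_mul, galPoly_mul, galPoly_map]
  | add x y hx hy => rw [smul_add, map_add, map_add, smul_add, hx, hy]

/-- The `A`-linear action of the Galois group on `M_{K^sep}` through the coefficients. -/
def galSep : Representation k[X] (GalK K) M.sep.carrier where
  toFun g :=
    { toFun := LinearMap.rTensor M.carrier (galPoly g)
      map_add' := map_add _
      map_smul' := fun a x => M.rTensor_galPoly_smul g a x }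
  map_one' := by
    refine LinearMap.ext fun x => ?_
    change LinearMap.rTensor M.carrier (galPoly (1 : GalK K)) x = x
    have h : galPoly (1 : GalK K) = LinearMap.id :=
      LinearMap.ext fun a => Polynomial.map_id
    rw [h, LinearMap.rTensor_id]
    rfl
  map_mul' g h := by
    refine LinearMap.ext fun x => ?_
    change LinearMap.rTensor M.carrier (galPoly (g * h)) x =
      LinearMap.rTensor M.carrier (galPoly g) (LinearMap.rTensor M.carrier (galPoly h) x)
    have e : galPoly (g * h) = galPoly g ∘ₗ galPoly h :=
      LinearMap.ext fun a => (Polynomial.map_map (h : SeparableClosure K →+* SeparableClosure K)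
        (g : SeparableClosure K →+* SeparableClosure K) a).symm
    rw [e, LinearMap.rTensor_comp]
    rfl

theorem galSep_sigma (g : GalK K) :
    M.galSep g ∘ₗ M.sep.sigmaA = M.sep.sigmaA ∘ₗ M.galSep g := by
  refine LinearMap.ext fun x => ?_
  change LinearMap.rTensor M.carrier (galPoly g)
      (TensorProduct.map (frobXSemilinear (k := k) (R := K) (SeparableClosure K)) M.σ x) =
    TensorProduct.map (frobXSemilinear (k := k) (R := K) (SeparableClosure K)) M.σ
      (LinearMap.rTensor M.carrier (galPoly g) x)
  induction x using TensorProduct.induction_on with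
  | zero => simp
  | tmul b m =>
    rw [TensorProduct.map_tmul, LinearMap.rTensor_tmul, LinearMap.rTensor_tmul,
      TensorProduct.map_tmul]
    congr 1
    change Polynomial.map (g : SeparableClosure K →+* SeparableClosure K)
        (Polynomial.map _ b) =
      Polynomial.map _ (Polynomial.map (g : SeparableClosure K →+* SeparableClosure K) b)
    rw [Polynomial.map_map, Polynomial.map_map]
    congr 1
    ext y
    simp
  | add x y hx hy => rw [map_add, map_add, map_add, map_add, hx, hy]

variable (l : Ideal k[X])

/-- `T_λ(M) = lim_n (M_{K^sep} / λ^n M_{K^sep})^{σ = 1}`, as a module over the `λ`-adic completion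
`A_λ` of `A`. -/
def tateModule : Submodule (AdicCompletion l k[X]) (AdicCompletion l M.sep.carrier) :=
  LinearMap.ker (AdicCompletion.map l M.sep.sigmaA - LinearMap.id)

/-- The Galois action on `T_λ(M)`. -/
def tateRep : Representation (AdicCompletion l k[X]) (GalK K) (M.tateModule l) where
  toFun g := (AdicCompletion.map l (M.galSep g)).restrict (fun x hx => by
    have hx' : AdicCompletion.map l M.sep.sigmaA x = x := by
      simpa [tateModule, sub_eq_zero] using hx
    have h : AdicCompletion.map l M.sep.sigmaA (AdicCompletion.map l (M.galSep g) x) =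
        AdicCompletion.map l (M.galSep g) x := by
      rw [AdicCompletion.map_comp_apply, ← galSep_sigma, ← AdicCompletion.map_comp_apply, hx']
    simpa [tateModule, sub_eq_zero] using h)
  map_one' := by
    refine LinearMap.ext fun x => Subtype.ext ?_
    change AdicCompletion.map l (M.galSep 1) x.1 = x.1
    rw [map_one]
    exact LinearMap.congr_fun (AdicCompletion.map_id l M.sep.carrier) x.1
  map_mul' g h := by
    refine LinearMap.ext fun x => Subtype.ext ?_
    change AdicCompletion.map l (M.galSep (g * h)) x.1 =
      AdicCompletion.map l (M.galSep g) (AdicCompletion.map l (M.galSep h) x.1)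
    rw [map_mul, AdicCompletion.map_comp_apply]
    rfl

variable (k) in
/-- `F_λ = A_λ ⊗_A F`. -/
abbrev FLambda : Type u := AdicCompletion l k[X] ⊗[k[X]] RatFunc k

/-- `V_λ(M) = F_λ ⊗_{A_λ} T_λ(M)`. -/
abbrev VLambda : Type _ := FLambda k l ⊗[AdicCompletion l k[X]] M.tateModule l

/-- The Galois representation `ρ_λ` on `V_λ(M)`. -/
def galRep : Representation (FLambda k l) (GalK K) (M.VLambda l) :=
  ((Module.End.baseChangeHom (AdicCompletion l k[X]) (FLambda k l) (M.tateModule l) :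
    Module.End (AdicCompletion l k[X]) (M.tateModule l) →* _)).comp (M.tateRep l)

end Field

end SigmaModule

end Galois

/-! ## Frobenius elements -/

section Frobenius

variable {R : Type*} [CommRing R] {K : Type*} [Field K] [Algebra R K]
  [Algebra R (SeparableClosure K)] [IsScalarTower R K (SeparableClosure K)]

/-- `g ∈ Gal(K^sep / K)` is a geometric Frobenius element at the prime `v` of `R ⊂ K`: its inverse
`φ` satisfies `φ x ≡ x^#(R/v)` modulo some prime above `v` of the integral closure of `R` in
`K^sep`. -/
def IsGeometricFrobenius (v : Ideal R) (g : SigmaModule.GalK K) : Prop :=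
  ∃ Q : Ideal (integralClosure R (SeparableClosure K)),
    Q.IsPrime ∧ Q.under R = v ∧
    AlgHom.IsArithFrobAt
      (((g⁻¹).restrictScalars R).mapIntegralClosure :
        integralClosure R (SeparableClosure K) →ₐ[R] integralClosure R (SeparableClosure K)) Q

end Frobenius

/-! ## `t`-motives over `K` -/

section Motives

variable {k : Type u} [Field k] [Fintype k]
variable {K : IntermediateField (ratTheta k) (Kinf k)}

/-- The ring homomorphism `i : A → O_K`, `t ↦ θ`. -/
def toOK (k : Type u) [Field k] [Fintype k] (K : IntermediateField (ratTheta k) (Kinf k)) :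
    k[X] →ₐ[k] OK k K := Polynomial.aeval (thetaO k K)

/-- The finite places of `K`: the non-zero prime ideals of `O_K`. -/
abbrev FinitePlace (k : Type u) [Field k] [Fintype k]
    (K : IntermediateField (ratTheta k) (Kinf k)) : Type u :=
  IsDedekindDomain.HeightOneSpectrum (OK k K)

namespace SigmaModule

variable (M : SigmaModule.{u, u, w} k K)

/-- `M` is an effective `t`-motive: it is non-degenerate and `det M` is isomorphic to
`(K[t] e, e ↦ α (t - θ)^n e)` for some `α ∈ K^×` and `n ≥ 0`. -/
def IsEffective : Prop :=
  M.DetNonzero ∧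
  ∃ (α : K) (n : ℕ) (f : ⋀[K[X]]^M.rank M.carrier ≃ₗ[K[X]] K[X]), α ≠ 0 ∧
    ∀ m : Fin M.rank → M.carrier,
      f (exteriorPower.ιMulti K[X] M.rank (fun i => M.σ (m i))) =
        frobX k K (f (exteriorPower.ιMulti K[X] M.rank m)) *
          (C α * (X - C (thetaK k K)) ^ n)

/-- A good model of `M`: a non-degenerate `σ`-module over `O_K` with an isomorphism of
`σ`-modules `α : ℳ_K ≅ M`. -/
structure GoodModel where
  model : SigmaModule.{u, u, w} k (OK k K)
  nondegenerate : model.Nondegenerate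
  α : (model.baseChange K).carrier ≃ₗ[K[X]] M.carrier
  α_σ : ∀ m, α ((model.baseChange K).σ m) = M.σ (α m)

/-- `M` has everywhere good reduction. -/
def HasGoodReduction : Prop := Nonempty M.GoodModel

/-! ### Uniformization -/

/-- `e : Lie_E(ℂ_∞) → E(ℂ_∞)` is the exponential of `E`: it is `A`-linear, entire and tangent to
the identity. The elements `m ∈ M` are the additive functions on `E` that generate its coordinate
ring, so `e` is entire when each `ξ ↦ e(ξ)(m)` is given by an everywhere convergent power series in
linear coordinates on `Lie_E(ℂ_∞)`; it is tangent to the identity when the linear part of that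
series is `ξ ↦ ξ(m)`. -/
def IsExponential (e : M.LiePoints (Cinf k) →ₗ[k[X]] M.EPoints (Cinf k)) : Prop :=
  ∃ (d : ℕ) (b : Module.Basis (Fin d) (Cinf k) (M.LiePoints (Cinf k))), ∀ m : M.carrier,
    ∃ p : MvPowerSeries (Fin d) (Cinf k),
      (∀ ξ, HasSum (fun n : Fin d →₀ ℕ =>
        MvPowerSeries.coeff n p * n.prod (fun i j => b.repr ξ i ^ j)) ((e ξ).1 m)) ∧
      ∀ i, MvPowerSeries.coeff (Finsupp.single i 1) p = (b i).1 m

/-- `E` is uniformizable: its exponential is surjective. -/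
def Uniformizable : Prop :=
  ∃ e : M.LiePoints (Cinf k) →ₗ[k[X]] M.EPoints (Cinf k),
    M.IsExponential e ∧ Function.Surjective e

/-! ### The special value `L(E, 0) = L(M^∨, 0)` -/

/-- `P` is the polynomial `P_v(X) = det (1 - X ρ_λ(Frob_v)) ∈ F[X]` of the dual `M^∨`, where
`Frob_v` is a geometric Frobenius element and `ρ_λ` is the representation on the finite dimensional
space `V_λ(M^∨) = V_λ(M)^∨`, for all non-zero primes `λ` of `A` with `i(λ)` coprime to `v`. -/
def IsDualEulerFactor (v : FinitePlace k K) (P : (RatFunc k)[X]) : Prop :=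
  ∀ l : Ideal k[X], l.IsPrime → l ≠ ⊥ → l ≠ v.asIdeal.comap (toOK k K) →
    ∃ (r : ℕ) (b : Module.Basis (Fin r) (FLambda k l) (M.VLambda l)),
      ∀ g : GalK K, IsGeometricFrobenius v.asIdeal g →
        P.map (Algebra.TensorProduct.includeRight :
            RatFunc k →ₐ[k[X]] FLambda k l).toRingHom =
          (LinearMap.toMatrix b.dualBasis b.dualBasis ((M.galRep l).dual g)).charpolyRev

/-- `L` is the value at `0` of the `L`-function of `M^∨`, that is, the Euler product
`∏_v P_v(1)⁻¹` over all finite places (`𝒩v^0 = 1`) converges to `L` in `F_∞`. -/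
def HasDualLValue (L : Kinf k) : Prop :=
  ∃ P : FinitePlace k K → (RatFunc k)[X], (∀ v, M.IsDualEulerFactor v (P v)) ∧
    HasProd (fun v => (ratToKinf k ((P v).eval 1))⁻¹) L

/-! ### Integral structures and the conjecture -/

variable {M}

/-- `E(O_K) ⊂ E(K)`, the image of `Hom_{O_K[τ]}(ℳ, O_K)`. -/
def GoodModel.integralE (N : M.GoodModel) : Set (M.EPoints K) :=
  {f | ∃ g : N.model.EPoints (OK k K), ∀ m,
    f.1 (N.α (N.model.toBaseChange K m)) = algebraMap (OK k K) K (g.1 m)}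

/-- `Lie_E(O_K) ⊂ Lie_E(K)`, the image of `Hom_{O_K}(ℳ / σℳ, O_K)`. -/
def GoodModel.integralLie (N : M.GoodModel) : Set (M.LiePoints K) :=
  {ξ | ∃ g : N.model.LiePoints (OK k K), ∀ m,
    ξ.1 (N.α (N.model.toBaseChange K m)) = algebraMap (OK k K) K (g.1 m)}

variable (M)

/-- `W_E(K_∞)`; the action of `A` on it is that of `𝔽_q[θ] ⊂ K_∞`, by `t = θ`. -/
abbrev WInf : Type _ := M.WPoints (Kinf k) (theta k)

/-- The projection `w : Lie_E(K_∞) → W_E(K_∞)`. -/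
def w : M.LiePoints (Kinf k) →ₗ[Kinf k] M.WInf := Submodule.mkQ _

variable {M}

/-- `W_E(O_K)`, the image of `Lie_E(O_K)` under `w`, as a subset of `W_E(K_∞) ⊃ W_E(K)`. -/
def GoodModel.integralW (N : M.GoodModel) : Set M.WInf :=
  (fun ξ => M.w (M.lieMap (IsScalarTower.toAlgHom K K (Kinf k)) ξ)) '' N.integralLie

variable (M)

/-- The image of `⋀^n_A S` in `⋀^n_{K_∞} W_E(K_∞)`, where `A` acts as `𝔽_q[θ]`. -/
def wedgeLattice (n : ℕ) (S : Set M.WInf) :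
    Submodule (Algebra.adjoin k {theta k}) (⋀[Kinf k]^n M.WInf) :=
  Submodule.span _ {x | ∃ s : Fin n → M.WInf, (∀ i, s i ∈ S) ∧ exteriorPower.ιMulti (Kinf k) n s = x}

/-- The conclusion of the conjecture for the `t`-module `E` of `M`: there is an `A`-submodule
`Z ⊂ Lie_E(K_∞)` of rank `d = dim W_E` with `exp_E(Z) ⊂ E(O_K)` and
`⋀^d_A w(Z) = L(E, 0) ⋀^d_A W_E(O_K)`. -/
def ConjectureHolds : Prop :=
  ∃ (N : M.GoodModel) (e : M.LiePoints (Cinf k) →ₗ[k[X]] M.EPoints (Cinf k)) (L : Kinf k)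
    (Z : Submodule k[X] (M.LiePoints (Kinf k))),
    M.IsExponential e ∧ M.HasDualLValue L ∧
    Module.rank k[X] Z = Module.finrank (Kinf k) M.WInf ∧
    (∀ z ∈ Z, ∃ f ∈ N.integralE,
      e (M.lieMap (IsScalarTower.toAlgHom K (Kinf k) (Cinf k)) z) =
        M.EMap (IsScalarTower.toAlgHom K K (Cinf k)) f) ∧
    (M.wedgeLattice (Module.finrank (Kinf k) M.WInf) (M.w '' (Z : Set (M.LiePoints (Kinf k)))) :
        Set (⋀[Kinf k]^(Module.finrank (Kinf k) M.WInf) M.WInf)) =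
      (fun x => L • x) '' (M.wedgeLattice (Module.finrank (Kinf k) M.WInf) N.integralW :
        Set (⋀[Kinf k]^(Module.finrank (Kinf k) M.WInf) M.WInf))

end SigmaModule

end Motives

end TMotive

end

/-! ## Determinants and products of bases -/

section DetProd

open Module

variable {R : Type*} [CommRing R] {V W : Type*} [AddCommGroup V] [Module R V] [AddCommGroup W]
  [Module R W] {ι κ : Type*}

/-! Every object attached to a motive turns a direct sum into a product. In a concatenated basis σ
is block diagonal, so det σ is multiplicative; this gives effectivity and, after base change to
fields, non-degeneracy of the sum of two good models. The functors E, Lie and W take direct sums to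
products, so the exponential of the sum is the product of the exponentials and is surjective when
both are. The Tate module is additive and compatible with Galois, so the Euler factors multiply, and
with them the convergent Euler products: the L-value of the sum is L·L'.

For the conjecture, take Z × Z' as the submodule of the Lie algebra. The point that is not formal is
the comparison of top exterior powers. A basis of W_E identifies its top exterior power with K_∞
through the determinant (`exteriorPowerTopEquiv`), and the lattice generated by a set S becomes the
A-span of the determinants of families in S (`detSpan`). The key fact is `detSpan_prod`: if S and T
contain 0, the span for S × T is the product of the spans for S and T, as A-submodules of K_∞. To
see this, split each vector of a family into its two components and expand multilinearly; a term
survives only if the numbers of vectors from the two factors are the two dimensions, and it is then,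
up to sign, a block diagonal determinant. The two given identities are then multiplied: (L·Q)(L'·Q')
= LL'·QQ'.

Finite generation over K[τ] makes W_E finite dimensional (`FiniteOverTau.finite_lie`), so that bases
exist and the dimensions add. -/

theorem Module.Basis.prod_toMatrix_elim (b : Basis ι R V) (c : Basis κ R W) (v : ι → V)
    (w : κ → W) :
    (b.prod c).toMatrix (Sum.elim (fun i => (v i, 0)) (fun j => (0, w j))) =
      Matrix.fromBlocks (b.toMatrix v) 0 0 (c.toMatrix w) := by
  ext i j
  rcases i with i | i <;> rcases j with j | j <;> simp [Basis.toMatrix_apply, Basis.prod]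

variable [Fintype ι] [Fintype κ] [DecidableEq ι] [DecidableEq κ]

theorem Module.Basis.prod_det_elim (b : Basis ι R V) (c : Basis κ R W) (v : ι → V) (w : κ → W) :
    (b.prod c).det (Sum.elim (fun i => (v i, 0)) (fun j => (0, w j))) = b.det v * c.det w := by
  rw [Basis.det_apply, Basis.prod_toMatrix_elim, Matrix.det_fromBlocks_zero₂₁, Basis.det_apply,
    Basis.det_apply]

variable (A : Type*) [CommRing A] [Algebra A R]

/-- The `A`-span of the determinants, in a basis, of the families of vectors in a set. -/
def detSpan (b : Basis ι R V) (S : Set V) : Submodule A R :=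
  Submodule.span A {x | ∃ s : ι → V, (∀ i, s i ∈ S) ∧ b.det s = x}

variable {A}

theorem detSpan_reindex (b : Basis ι R V) (e : ι ≃ κ) (S : Set V) :
    detSpan A (b.reindex e) S = detSpan A b S := by
  refine congrArg (Submodule.span A) (Set.ext fun x => ⟨?_, ?_⟩)
  · rintro ⟨s, hs, rfl⟩
    exact ⟨s ∘ e, fun i => hs _, (b.det_reindex s e).symm⟩
  · rintro ⟨s, hs, rfl⟩
    refine ⟨s ∘ e.symm, fun i => hs _, ?_⟩
    rw [b.det_reindex]
    congr 1
    ext i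
    simp

theorem detSpan_map (b : Basis ι R V) (e : V ≃ₗ[R] W) (S : Set W) :
    detSpan A (b.map e) S = detSpan A b (e ⁻¹' S) := by
  refine congrArg (Submodule.span A) (Set.ext fun x => ⟨?_, ?_⟩)
  · rintro ⟨s, hs, rfl⟩
    exact ⟨e.symm ∘ s, fun i => by simpa using hs i, (b.det_map e s).symm⟩
  · rintro ⟨s, hs, rfl⟩
    refine ⟨e ∘ s, fun i => hs i, ?_⟩
    rw [b.det_map]
    congr 1
    ext i
    simp

/-- Here `P` records which vectors come from `V`. A nonzero determinant has a nonzero Leibniz term,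
hence a permutation `p` such that `f i` has nonzero coordinate at `p i`. Such a `p` must match the
vectors from `V` with `ι` and those from `W` with `κ`. Reordering by `p` makes the matrix block
diagonal, and the sign is harmless in a submodule. -/
theorem det_mem_detSpan_mul (b : Basis ι R V) (c : Basis κ R W) {S : Set V} {T : Set W}
    (f : ι ⊕ κ → V × W) (P : ι ⊕ κ → Prop)
    (h1 : ∀ i, P i → ∃ x ∈ S, f i = (x, 0)) (h2 : ∀ i, ¬ P i → ∃ y ∈ T, f i = (0, y)) :
    (b.prod c).det f ∈ detSpan A b S * detSpan A c T := by
  by_cases h0 : (b.prod c).det f = 0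
  · rw [h0]
    exact Submodule.zero_mem _
  obtain ⟨p, hp⟩ : ∃ p : Equiv.Perm (ι ⊕ κ), ∀ i, (b.prod c).toMatrix f (p i) i ≠ 0 := by
    by_contra! h
    refine h0 ?_
    rw [Basis.det_apply, Matrix.det_apply]
    refine Finset.sum_eq_zero fun p _ => ?_
    obtain ⟨i, hi⟩ := h p
    have hz : ∏ j, (b.prod c).toMatrix f (p j) j = 0 :=
      Finset.prod_eq_zero (f := fun j => (b.prod c).toMatrix f (p j) j) (Finset.mem_univ i) hi
    exact (congrArg (Equiv.Perm.sign p • ·) hz).trans (smul_zero _)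
  have hl (i : ι) : P (p.symm (Sum.inl i)) := by
    by_contra hn
    obtain ⟨y, -, hy⟩ := h2 _ hn
    refine hp (p.symm (Sum.inl i)) ?_
    simp [Basis.toMatrix_apply, hy, Basis.prod]
  have hr (j : κ) : ¬ P (p.symm (Sum.inr j)) := by
    intro hn
    obtain ⟨x, -, hx⟩ := h1 _ hn
    refine hp (p.symm (Sum.inr j)) ?_
    simp [Basis.toMatrix_apply, hx, Basis.prod]
  choose x hxS hx using fun i => h1 _ (hl i)
  choose y hyT hy using fun j => h2 _ (hr j)
  have hf : f ∘ p.symm = Sum.elim (fun i => (x i, 0)) (fun j => (0, y j)) := by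
    ext1 i
    rcases i with i | i
    · exact hx i
    · exact hy i
  have hmem : (b.prod c).det (f ∘ p.symm) ∈ detSpan A b S * detSpan A c T := by
    rw [hf, Basis.prod_det_elim]
    exact Submodule.mul_mem_mul (Submodule.subset_span ⟨x, hxS, rfl⟩)
      (Submodule.subset_span ⟨y, hyT, rfl⟩)
  rw [AlternatingMap.map_perm] at hmem
  rcases Int.units_eq_one_or (Equiv.Perm.sign p.symm) with hs | hs
  · simpa [hs] using hmem
  · rw [hs, Units.neg_smul, one_smul] at hmem
    exact neg_mem_iff.mp hmem

/-- The lattice spanned by the determinants of families in a product is the product of lattices. -/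
theorem detSpan_prod (b : Basis ι R V) (c : Basis κ R W) {S : Set V} {T : Set W}
    (hS : 0 ∈ S) (hT : 0 ∈ T) :
    detSpan A (b.prod c) (S ×ˢ T) = detSpan A b S * detSpan A c T := by
  classical
  refine le_antisymm (Submodule.span_le.mpr ?_) ?_
  · rintro _ ⟨s, hs, rfl⟩
    -- The multilinear expansion runs over the sets `p` of indices at which the `V`-component is
    -- kept.
    have hsum : s = (fun i => ((s i).1, (0 : W))) + (fun i => ((0 : V), (s i).2)) := by
      ext i <;> simp
    have hexp := (b.prod c).det.toMultilinearMap.map_add_univ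
      (fun i => ((s i).1, (0 : W))) (fun i => ((0 : V), (s i).2))
    rw [← hsum] at hexp
    change (b.prod c).det s = _ at hexp
    rw [SetLike.mem_coe, hexp]
    refine Submodule.sum_mem _ fun p _ => ?_
    refine det_mem_detSpan_mul b c _ (· ∈ p) (fun i hi => ?_) (fun i hi => ?_)
    · exact ⟨(s i).1, (hs i).1, by rw [Finset.piecewise_eq_of_mem _ _ _ hi]⟩
    · exact ⟨(s i).2, (hs i).2, by rw [Finset.piecewise_eq_of_notMem _ _ _ hi]⟩
  · rw [detSpan, detSpan, Submodule.span_mul_span]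
    refine Submodule.span_mono ?_
    rintro _ ⟨_, ⟨v, hv, rfl⟩, _, ⟨w, hw, rfl⟩, rfl⟩
    -- Here 0 must lie in both sets: the padded vectors `(v i, 0)` and `(0, w j)` have to belong to
    -- `S ×ˢ T`.
    refine ⟨_, ?_, b.prod_det_elim c v w⟩
    rintro (i | j)
    · exact ⟨hv i, hT⟩
    · exact ⟨hS, hw j⟩

theorem detSpan_reindex_map_prod {U μ : Type*} [AddCommGroup U] [Module R U] [Fintype μ]
    [DecidableEq μ] (b : Basis ι R V) (c : Basis κ R W) (φ : (V × W) ≃ₗ[R] U) (e : ι ⊕ κ ≃ μ)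
    {S : Set U} {S₁ : Set V} {S₂ : Set W} (h : φ ⁻¹' S = S₁ ×ˢ S₂) (h₁ : 0 ∈ S₁) (h₂ : 0 ∈ S₂) :
    detSpan A (((b.prod c).map φ).reindex e) S = detSpan A b S₁ * detSpan A c S₂ := by
  rw [detSpan_reindex, detSpan_map, h, detSpan_prod b c h₁ h₂]

end DetProd

/-! ## The top exterior power -/

section Top

open Module

variable {R : Type*} [CommRing R] {V : Type*} [AddCommGroup V] [Module R V] {n : ℕ}

/-- The identification of the top exterior power of a free module with the base ring given by the
determinant in a basis. -/
noncomputable def exteriorPowerTopEquiv (b : Basis (Fin n) R V) : ⋀[R]^n V ≃ₗ[R] R :=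
  LinearEquiv.ofLinearMap (exteriorPower.alternatingMapLinearEquiv b.det)
    (LinearMap.toSpanSingleton R _ (exteriorPower.ιMulti R n b))
    (by
      ext
      simp [b.det_self])
    (by
      ext1
      -- Alternating maps are determined on injective families of basis vectors. Indexed by `Fin n`,
      -- these are permutations of `b`, on which both sides give the sign times the wedge of `b`.
      refine Basis.ext_alternating b fun i hi => ?_
      obtain ⟨p, rfl⟩ : ∃ p : Equiv.Perm (Fin n), i = p :=
        ⟨Equiv.ofBijective i (Finite.injective_iff_bijective.mp hi), rfl⟩
      have h1 : (fun j => b (p j)) = b ∘ p := rfl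
      simp [h1, AlternatingMap.map_perm, b.det_self])

theorem exteriorPowerTopEquiv_ιMulti (b : Basis (Fin n) R V) (s : Fin n → V) :
    exteriorPowerTopEquiv b (exteriorPower.ιMulti R n s) = b.det s := by
  simp [exteriorPowerTopEquiv]

theorem ιMulti_ne_zero_iff (b : Basis (Fin n) R V) (s : Fin n → V) :
    exteriorPower.ιMulti R n s ≠ 0 ↔ b.det s ≠ 0 := by
  rw [← exteriorPowerTopEquiv_ιMulti, (exteriorPowerTopEquiv b).map_ne_zero_iff]

/-- Linear equivalences from the top exterior power are unit multiples of the determinant. -/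
theorem exists_unit_eq_det (b : Basis (Fin n) R V) (f : ⋀[R]^n V ≃ₗ[R] R) :
    ∃ c : R, IsUnit c ∧ ∀ s, f (exteriorPower.ιMulti R n s) = c * b.det s := by
  refine ⟨f ((exteriorPowerTopEquiv b).symm 1), ?_, fun s => ?_⟩
  · have h : ∀ x : R, f ((exteriorPowerTopEquiv b).symm x) =
        x * f ((exteriorPowerTopEquiv b).symm 1) := fun x => by
      rw [← smul_eq_mul, ← map_smul, ← map_smul, smul_eq_mul, mul_one]
    refine IsUnit.of_mul_eq_one (exteriorPowerTopEquiv b (f.symm 1)) ?_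
    rw [mul_comm, ← h]
    simp
  · rw [mul_comm, ← smul_eq_mul, ← map_smul, ← map_smul, smul_eq_mul, mul_one,
      ← exteriorPowerTopEquiv_ιMulti, LinearEquiv.symm_apply_apply]

end Top

/-! ## Reverse characteristic polynomials -/

section CharpolyRev

open scoped Matrix

variable {R : Type*} [CommRing R] {m n : Type*} [Fintype m] [Fintype n] [DecidableEq m]
  [DecidableEq n]

theorem Matrix.charpolyRev_transpose' (M : Matrix n n R) : Mᵀ.charpolyRev = M.charpolyRev := by
  rw [charpolyRev, charpolyRev, ← det_transpose, transpose_sub, transpose_one, transpose_smul,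
    ← transpose_map, transpose_transpose]

theorem Matrix.charpolyRev_fromBlocks_diagonal (M : Matrix m m R) (N : Matrix n n R) :
    (fromBlocks M 0 0 N).charpolyRev = M.charpolyRev * N.charpolyRev := by
  rw [charpolyRev, charpolyRev, charpolyRev, ← det_fromBlocks_zero₂₁ _ 0]
  congr 1
  ext i j : 2
  rcases i with i | i <;> rcases j with j | j <;> simp [Matrix.one_apply]

theorem Matrix.charpolyRev_reindex' (e : m ≃ n) (M : Matrix m m R) :
    (reindex e e M).charpolyRev = M.charpolyRev := by
  rw [charpolyRev, charpolyRev, ← det_reindex_self e]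
  congr 1
  ext i j : 2
  simp [Matrix.one_apply]

end CharpolyRev

/-! ## Renaming variables in convergent power series -/

section Rename

/-- The renamed series is supported on the exponents extended by zero along `f`, so its sum is the
original one with other names for the indices, and no new convergence question arises. -/
theorem MvPowerSeries.hasSum_rename {R : Type*} [CommRing R] [TopologicalSpace R] {ι κ : Type*}
    [Finite ι] (f : ι ↪ κ) (p : MvPowerSeries ι R) (x : κ → R) {a : R}
    (h : HasSum (fun n : ι →₀ ℕ => coeff n p * n.prod (fun i j => x (f i) ^ j)) a) :
    HasSum (fun n : κ →₀ ℕ => coeff n (rename f p) * n.prod (fun i j => x i ^ j)) a := by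
  rw [← (Finsupp.embDomain_injective f).hasSum_iff]
  · convert h using 2 with n
    rw [Function.comp_apply, coeff_embDomain_rename, Finsupp.prod_embDomain]
  · intro n hn
    rw [coeff_rename_eq_zero, zero_mul]
    intro hn'
    exact hn (by simpa [Finsupp.embDomain_eq_mapDomain] using hn')

theorem MvPowerSeries.coeff_single_rename {R : Type*} [CommRing R] {ι κ : Type*}
    [Finite ι] (f : ι ↪ κ) (p : MvPowerSeries ι R) (i : ι) :
    coeff (Finsupp.single (f i) 1) (rename f p) = coeff (Finsupp.single i 1) p := by
  rw [← Finsupp.embDomain_single, coeff_embDomain_rename]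

/-- Used for tangency to the identity: the series of one summand has no linear term in the
coordinates of the other. -/
theorem MvPowerSeries.coeff_single_rename_of_notMem {R : Type*} [CommRing R] {ι κ : Type*}
    [Finite ι] (f : ι ↪ κ) (p : MvPowerSeries ι R) {j : κ} (hj : j ∉ Set.range f) :
    coeff (Finsupp.single j 1) (rename f p) = 0 := by
  refine coeff_rename_eq_zero _ _ ?_
  rintro ⟨x, hx⟩
  rw [← Finsupp.embDomain_eq_mapDomain] at hx
  have h := DFunLike.congr_fun hx j
  rw [Finsupp.embDomain_of_notMem_range _ _ _ hj, Finsupp.single_eq_same] at h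
  exact zero_ne_one h

end Rename

noncomputable section

namespace TMotive

namespace SigmaModule

/-! ## Determinants of `σ`-modules over fields -/

section Det

open Module

variable {k : Type u} [Field k] [Fintype k]

/-- Since σ is Frobenius-semilinear, the matrix of σ ∘ s is the matrix of σ times the Frobenius
twist of the matrix of s. Thus det σ is governed by one polynomial, its value on the basis. -/
theorem det_σ_comp {R : Type v} [CommRing R] [Algebra k R] (M : SigmaModule.{u, v, w} k R)
    {ι : Type*} [Fintype ι] [DecidableEq ι] (b : Basis ι R[X] M.carrier) (s : ι → M.carrier) :
    b.det (fun i => M.σ (s i)) = frobX k R (b.det s) * b.det (fun i => M.σ (b i)) := by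
  have h : b.toMatrix (fun i => M.σ (s i)) =
      b.toMatrix (fun i => M.σ (b i)) * (b.toMatrix s).map (frobX k R) := by
    refine Matrix.ext fun i j => ?_
    rw [Matrix.mul_apply]
    simp only [Basis.toMatrix_apply, Matrix.map_apply]
    conv_lhs => rw [← b.sum_repr (s j)]
    simp only [map_sum, map_smulₛₗ, Finsupp.coe_finsetSum, Finset.sum_apply, Finsupp.smul_apply,
      smul_eq_mul, RingHom.id_apply]
    exact Finset.sum_congr rfl fun x _ => mul_comm (frobX k R _) (b.repr (M.σ (b x)) i)
  rw [Basis.det_apply, h, Matrix.det_mul, mul_comm, Basis.det_apply, Basis.det_apply,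
    ← RingHom.mapMatrix_apply, ← RingHom.map_det]

theorem exteriorPowerTopEquiv_σ {R : Type v} [CommRing R] [Algebra k R]
    (M : SigmaModule.{u, v, w} k R) (b : Basis (Fin M.rank) R[X] M.carrier)
    (m : Fin M.rank → M.carrier) :
    exteriorPowerTopEquiv b (exteriorPower.ιMulti R[X] M.rank (fun i => M.σ (m i))) =
      frobX k R (exteriorPowerTopEquiv b (exteriorPower.ιMulti R[X] M.rank m)) *
        b.det (fun i => M.σ (b i)) := by
  rw [exteriorPowerTopEquiv_ιMulti, exteriorPowerTopEquiv_ιMulti, det_σ_comp]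

/-- By `det_σ_comp` every value of det σ is a multiple of the value on `b`, so it is enough to test
`b`. -/
theorem detNonzero_iff {R : Type v} [CommRing R] [IsDomain R] [Algebra k R]
    (M : SigmaModule.{u, v, w} k R) (b : Basis (Fin M.rank) R[X] M.carrier) :
    M.DetNonzero ↔ b.det (fun i => M.σ (b i)) ≠ 0 := by
  constructor
  · rintro ⟨m, hm⟩ h
    rw [ιMulti_ne_zero_iff b, det_σ_comp, h, mul_zero] at hm
    exact hm rfl
  · intro h
    exact ⟨b, (ιMulti_ne_zero_iff b _).mpr h⟩

/-- Finitely generated projective modules over the principal ideal domain `L[X]` are free; the size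
of a basis is read off at the generic point. -/
theorem exists_basis {L : Type v} [Field L] [Algebra k L] (M : SigmaModule.{u, v, w} k L) :
    Nonempty (Basis (Fin M.rank) L[X] M.carrier) := by
  have : Module.Free L[X] M.carrier := inferInstance
  have h : Module.finrank L[X] M.carrier = M.rank := by
    have h2 := M.rank_eq ⟨⊥, Ideal.isPrime_bot⟩
    rwa [Module.rankAtStalk_eq_finrank_of_free, Pi.natCast_apply, Nat.cast_id] at h2
  exact ⟨Module.finBasisOfFinrankEq _ _ h⟩

/-- The basis of a direct sum obtained from bases of the summands. -/
def prodBasis {R : Type v} [CommRing R] [Algebra k R] {M N : SigmaModule.{u, v, w} k R}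
    (b : Basis (Fin M.rank) R[X] M.carrier) (c : Basis (Fin N.rank) R[X] N.carrier) :
    Basis (Fin (M.prod N).rank) R[X] (M.prod N).carrier :=
  (show Basis (Fin M.rank ⊕ Fin N.rank) R[X] (M.prod N).carrier from b.prod c).reindex
    finSumFinEquiv

/-- The matrix of σ in the concatenated basis is block diagonal. -/
theorem prodBasis_det_σ {R : Type v} [CommRing R] [Algebra k R] {M N : SigmaModule.{u, v, w} k R}
    (b : Basis (Fin M.rank) R[X] M.carrier) (c : Basis (Fin N.rank) R[X] N.carrier) :
    (prodBasis b c).det (fun i => (M.prod N).σ (prodBasis b c i)) =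
      b.det (fun i => M.σ (b i)) * c.det (fun i => N.σ (c i)) := by
  rw [← Basis.prod_det_elim]
  refine (Basis.det_reindex _ _ _).trans ?_
  congr 1
  ext1 i
  have h : prodBasis b c (finSumFinEquiv i) = b.prod c i :=
    (Basis.reindex_apply _ _ _).trans (congrArg _ (Equiv.symm_apply_apply _ _))
  refine (congrArg (M.prod N).σ h).trans ?_
  change (M.σ (b.prod c i).1, N.σ (b.prod c i).2) = _
  rcases i with i | i <;> simp [Basis.prod]

theorem DetNonzero.prod {L : Type v} [Field L] [Algebra k L] {M N : SigmaModule.{u, v, w} k L}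
    (hM : M.DetNonzero) (hN : N.DetNonzero) : (M.prod N).DetNonzero := by
  obtain ⟨b⟩ := M.exists_basis
  obtain ⟨c⟩ := N.exists_basis
  rw [detNonzero_iff M b] at hM
  rw [detNonzero_iff N c] at hN
  rw [detNonzero_iff _ (prodBasis b c), prodBasis_det_σ]
  exact mul_ne_zero hM hN

/-- Non-vanishing of `det σ` is invariant under isomorphisms. -/
theorem DetNonzero.of_equiv {R : Type v} [CommRing R] [Algebra k R] {M : SigmaModule.{u, v, w} k R}
    {N : SigmaModule.{u, v, w} k R} (hM : M.DetNonzero) (hr : M.rank = N.rank)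
    (e : M.carrier ≃ₗ[R[X]] N.carrier) (he : ∀ m, e (M.σ m) = N.σ (e m)) : N.DetNonzero := by
  obtain ⟨m, hm⟩ := hM
  rw [DetNonzero, ← hr]
  refine ⟨fun i => e (m i), fun h => hm ?_⟩
  have h2 := congrArg (exteriorPower.map M.rank e.symm.toLinearMap) h
  rw [exteriorPower.map_apply_ιMulti, map_zero] at h2
  rw [← h2]
  congr 1
  ext i
  simp [← he]

end Det

/-! ## Direct sums of effective motives -/

section Effective

open Module

variable {k : Type u} [Field k] [Fintype k] {K : IntermediateField (ratTheta k) (Kinf k)}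

/-- A trivialisation of det M differs from the determinant in a basis by a unit of K[t], which is a
constant a ∈ K^×. Changing the trivialisation multiplies det σ by a power of a, absorbed in α, so
effectivity can be tested in any basis. -/
theorem isEffective_iff (M : SigmaModule.{u, u, w} k K)
    (b : Basis (Fin M.rank) K[X] M.carrier) :
    M.IsEffective ↔ ∃ (α : K) (n : ℕ), α ≠ 0 ∧
      b.det (fun i => M.σ (b i)) = C α * (X - C (thetaK k K)) ^ n := by
  constructor
  · rintro ⟨-, α, n, f, hα, hf⟩
    obtain ⟨c, hc, hfc⟩ := exists_unit_eq_det b f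
    obtain ⟨a, ha, rfl⟩ := Polynomial.isUnit_iff.mp hc
    have h := hf b
    rw [hfc, hfc, b.det_self, mul_one] at h
    have ha0 : a ≠ 0 := ha.ne_zero
    have hfr : frobX k K (C a) = C (a ^ Fintype.card k) := by
      simp [frobX]
    -- Evaluating the effectivity relation at `b` gives a · det σ(b) = a^q α (t - θ)^n; this is
    -- solved for det σ(b).
    refine ⟨a⁻¹ * (a ^ Fintype.card k * α), n,
      mul_ne_zero (inv_ne_zero ha0) (mul_ne_zero (pow_ne_zero _ ha0) hα), ?_⟩
    rw [hfr] at h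
    rw [C_mul, mul_assoc, C_mul, mul_assoc, ← h, ← mul_assoc, ← C_mul, inv_mul_cancel₀ ha0, C_1,
      one_mul]
  · rintro ⟨α, n, hα, h⟩
    refine ⟨(detNonzero_iff M b).mpr ?_, α, n, exteriorPowerTopEquiv b, hα, fun m => ?_⟩
    · rw [h]
      exact mul_ne_zero (C_ne_zero.mpr hα) (pow_ne_zero _ (X_sub_C_ne_zero _))
    · exact (M.exteriorPowerTopEquiv_σ b m).trans (congrArg (frobX k K _ * ·) h)

theorem IsEffective.prod {M N : SigmaModule.{u, u, w} k K} (hM : M.IsEffective)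
    (hN : N.IsEffective) : (M.prod N).IsEffective := by
  obtain ⟨b⟩ := M.exists_basis
  obtain ⟨c⟩ := N.exists_basis
  obtain ⟨α, n, hα, h1⟩ := (isEffective_iff M b).mp hM
  obtain ⟨β, m, hβ, h2⟩ := (isEffective_iff N c).mp hN
  refine (isEffective_iff _ (prodBasis b c)).mpr ⟨α * β, n + m, mul_ne_zero hα hβ, ?_⟩
  rw [prodBasis_det_σ, h1, h2, C_mul, pow_add]
  ring

end Effective

/-! ## Direct sums and base change -/

section BaseChange

variable {k : Type u} [Field k] [Fintype k] {R : Type v} [CommRing R] [Algebra k R]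

/-- The generators of the two summands together generate: a σ-stable submodule containing them pulls
back along each inclusion to a σ-stable submodule containing the generators of that summand. -/
theorem FiniteOverTau.prod {M N : SigmaModule.{u, v, w} k R} (hM : M.FiniteOverTau)
    (hN : N.FiniteOverTau) : (M.prod N).FiniteOverTau := by
  classical
  obtain ⟨s, hs⟩ := hM
  obtain ⟨t, ht⟩ := hN
  let i1 : M.carrier →ₗ[R] (M.prod N).carrier := LinearMap.inl R M.carrier N.carrier
  let i2 : N.carrier →ₗ[R] (M.prod N).carrier := LinearMap.inr R M.carrier N.carrier
  refine ⟨s.image i1 ∪ t.image i2, fun P hP hσ => ?_⟩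
  have h1 : P.comap i1 = ⊤ := by
    refine hs _ (fun m hm => hP _ (Finset.mem_union_left _ (Finset.mem_image_of_mem _ hm)))
      fun m hm => ?_
    have h := hσ _ hm
    have e : (M.prod N).σ (i1 m) = i1 (M.σ m) := Prod.ext rfl (map_zero N.σ)
    rwa [e] at h
  have h2 : P.comap i2 = ⊤ := by
    refine ht _ (fun m hm => hP _ (Finset.mem_union_right _ (Finset.mem_image_of_mem _ hm)))
      fun m hm => ?_
    have h := hσ _ hm
    have e : (M.prod N).σ (i2 m) = i2 (N.σ m) := Prod.ext (map_zero M.σ) rfl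
    rwa [e] at h
  refine eq_top_iff.mpr fun x _ => ?_
  have hx : x = i1 x.1 + i2 x.2 := Prod.ext (add_zero x.1).symm (zero_add x.2).symm
  rw [hx]
  exact add_mem (show x.1 ∈ P.comap i1 from h1 ▸ Submodule.mem_top)
    (show x.2 ∈ P.comap i2 from h2 ▸ Submodule.mem_top)

variable (S : Type v) [CommRing S] [Algebra k S] [Algebra R S]

/-- Base change commutes with direct sums. -/
def baseChangeProd [IsScalarTower k R S] (M N : SigmaModule.{u, v, w} k R) :
    ((M.prod N).baseChange S).carrier ≃ₗ[S[X]]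
      ((M.baseChange S).prod (N.baseChange S)).carrier :=
  TensorProduct.prodRight R[X] S[X] S[X] M.carrier N.carrier

theorem baseChangeProd_σ [IsScalarTower k R S] (M N : SigmaModule.{u, v, w} k R)
    (x : ((M.prod N).baseChange S).carrier) :
    baseChangeProd S M N (((M.prod N).baseChange S).σ x) =
      ((M.baseChange S).prod (N.baseChange S)).σ (baseChangeProd S M N x) := by
  induction x using TensorProduct.induction_on with
  | zero => exact (congrArg _ (map_zero _)).trans ((map_zero _).trans
      ((congrArg _ (map_zero _)).trans (map_zero _)).symm)
  | tmul a m => rfl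
  | add x y hx hy =>
    exact (congrArg _ (map_add _ x y)).trans ((map_add _ _ _).trans ((congrArg₂ _ hx hy).trans
      ((congrArg _ (map_add _ x y)).trans (map_add _ _ _)).symm))

theorem Nondegenerate.prod {M N : SigmaModule.{u, v, w} k R} (hM : M.Nondegenerate)
    (hN : N.Nondegenerate) : (M.prod N).Nondegenerate := by
  intro L _ _ _ _
  refine ((hM L).prod (hN L)).of_equiv rfl (baseChangeProd L M N).symm fun m => ?_
  rw [LinearEquiv.symm_apply_eq, baseChangeProd_σ, LinearEquiv.apply_symm_apply]

end BaseChange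

/-! ## Direct sums of good models -/

section GoodModel

variable {k : Type u} [Field k] [Fintype k] {K : IntermediateField (ratTheta k) (Kinf k)}
  {M N : SigmaModule.{u, u, w} k K}

/-- The direct sum of good models. -/
def GoodModel.prod (P : M.GoodModel) (Q : N.GoodModel) : (M.prod N).GoodModel where
  model := P.model.prod Q.model
  nondegenerate := P.nondegenerate.prod Q.nondegenerate
  α := (baseChangeProd K P.model Q.model).trans (P.α.prodCongr Q.α)
  α_σ m := by
    have h := baseChangeProd_σ K P.model Q.model m
    refine (congrArg (P.α.prodCongr Q.α) h).trans ?_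
    exact Prod.ext (P.α_σ _) (Q.α_σ _)

theorem HasGoodReduction.prod (hM : M.HasGoodReduction) (hN : N.HasGoodReduction) :
    (M.prod N).HasGoodReduction :=
  hM.elim fun P => hN.elim fun Q => ⟨P.prod Q⟩

end GoodModel

end SigmaModule

end TMotive

end

noncomputable section

namespace TMotive

namespace SigmaModule

/-! ## Points of direct sums -/

section Points

variable {k : Type u} [Field k] [Fintype k] {R : Type v} [CommRing R] [Algebra k R]
  (M N : SigmaModule.{u, v, w} k R) (S : Type*) [CommRing S] [Algebra R S]

/-- The inclusion of the first summand. -/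
def inlR : M.carrier →ₗ[R] (M.prod N).carrier := LinearMap.inl R M.carrier N.carrier

/-- The inclusion of the second summand. -/
def inrR : N.carrier →ₗ[R] (M.prod N).carrier := LinearMap.inr R M.carrier N.carrier

/-- The map on a direct sum given by maps on the summands. -/
def coprodR {S : Type*} [CommRing S] [Algebra R S] (f : M.carrier →ₗ[R] S)
    (g : N.carrier →ₗ[R] S) : (M.prod N).carrier →ₗ[R] S :=
  LinearMap.coprod f g

variable {M N S} in
theorem coprodR_apply (f : M.carrier →ₗ[R] S) (g : N.carrier →ₗ[R] S)
    (m : (M.prod N).carrier) : coprodR M N f g m = f m.1 + g m.2 := rfl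

theorem σ_inlR (m : M.carrier) : (M.prod N).σ (inlR M N m) = inlR M N (M.σ m) :=
  Prod.ext rfl (map_zero N.σ)

theorem σ_inrR (m : N.carrier) : (M.prod N).σ (inrR M N m) = inrR M N (N.σ m) :=
  Prod.ext (map_zero M.σ) rfl

theorem smul_inlR (a : k[X]) (m : M.carrier) : a • inlR M N m = inlR M N (a • m) :=
  Prod.ext rfl (smul_zero (a.map (algebraMap k R)))

theorem smul_inrR (a : k[X]) (m : N.carrier) : a • inrR M N m = inrR M N (a • m) :=
  Prod.ext (smul_zero (a.map (algebraMap k R))) rfl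

theorem inlR_add_inrR (m : (M.prod N).carrier) : inlR M N m.1 + inrR M N m.2 = m :=
  Prod.ext (add_zero m.1) (zero_add m.2)

variable {M N S} in
theorem comp_eq_coprodR (f : (M.prod N).carrier →ₗ[R] S) :
    coprodR M N (f ∘ₗ inlR M N) (f ∘ₗ inrR M N) = f :=
  LinearMap.ext fun m => by
    rw [coprodR_apply, LinearMap.comp_apply, LinearMap.comp_apply, ← map_add, inlR_add_inrR]

variable {M N S} in
theorem coprodR_comp_inlR (f : M.carrier →ₗ[R] S) (g : N.carrier →ₗ[R] S) :
    coprodR M N f g ∘ₗ inlR M N = f :=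
  LinearMap.coprod_inl f g

variable {M N S} in
theorem coprodR_comp_inrR (f : M.carrier →ₗ[R] S) (g : N.carrier →ₗ[R] S) :
    coprodR M N f g ∘ₗ inrR M N = g :=
  LinearMap.coprod_inr f g

/-- The Lie algebra of a direct sum. -/
def lieProd : (M.prod N).LiePoints S ≃ₗ[S] M.LiePoints S × N.LiePoints S where
  toFun ξ := (⟨ξ.1 ∘ₗ inlR M N, fun m => by
      rw [LinearMap.comp_apply, ← σ_inlR]; exact ξ.2 _⟩,
    ⟨ξ.1 ∘ₗ inrR M N, fun m => by rw [LinearMap.comp_apply, ← σ_inrR]; exact ξ.2 _⟩)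
  map_add' _ _ := rfl
  map_smul' _ _ := rfl
  invFun p := ⟨coprodR M N p.1.1 p.2.1, fun m => by
    rw [coprodR_apply]
    exact (congrArg₂ _ (p.1.2 m.1) (p.2.2 m.2)).trans (add_zero 0)⟩
  left_inv ξ := Subtype.ext (comp_eq_coprodR ξ.1)
  right_inv p := Prod.ext (Subtype.ext (coprodR_comp_inlR p.1.1 p.2.1))
    (Subtype.ext (coprodR_comp_inrR p.1.1 p.2.1))

theorem lieProd_smul (a : k[X]) (ξ : (M.prod N).LiePoints S) :
    lieProd M N S (a • ξ) = a • lieProd M N S ξ :=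
  Prod.ext (Subtype.ext (LinearMap.ext fun m => congrArg ξ.1 (smul_inlR M N a m)))
    (Subtype.ext (LinearMap.ext fun m => congrArg ξ.1 (smul_inrR M N a m)))

/-- The Lie algebra of a direct sum, with its action of `A`. -/
def lieProdA : (M.prod N).LiePoints S ≃ₗ[k[X]] M.LiePoints S × N.LiePoints S :=
  { lieProd M N S with map_smul' := lieProd_smul M N S }

/-- The points of a direct sum. -/
def pointsProd : (M.prod N).EPoints S ≃ₗ[k[X]] M.EPoints S × N.EPoints S where
  toFun f := (⟨f.1 ∘ₗ inlR M N, fun m => by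
      rw [LinearMap.comp_apply, ← σ_inlR]; exact f.2 _⟩,
    ⟨f.1 ∘ₗ inrR M N, fun m => by rw [LinearMap.comp_apply, ← σ_inrR]; exact f.2 _⟩)
  map_add' _ _ := rfl
  map_smul' a f :=
    Prod.ext (Subtype.ext (LinearMap.ext fun m => congrArg f.1 (smul_inlR M N a m)))
      (Subtype.ext (LinearMap.ext fun m => congrArg f.1 (smul_inrR M N a m)))
  invFun p := ⟨coprodR M N p.1.1 p.2.1, by
    -- The two components are treated separately, so that additivity of the q-th power enters only
    -- through `EPoints` being a subgroup.
    have h1 : coprodR M N p.1.1 0 ∈ (M.prod N).EPoints S := fun m => by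
      rw [coprodR_apply, coprodR_apply, LinearMap.zero_apply, LinearMap.zero_apply, add_zero,
        add_zero]
      exact p.1.2 m.1
    have h2 : coprodR M N 0 p.2.1 ∈ (M.prod N).EPoints S := fun m => by
      rw [coprodR_apply, coprodR_apply, LinearMap.zero_apply, LinearMap.zero_apply, zero_add,
        zero_add]
      exact p.2.2 m.2
    have h : coprodR M N p.1.1 p.2.1 = coprodR M N p.1.1 0 + coprodR M N 0 p.2.1 :=
      LinearMap.ext fun m => by
        rw [LinearMap.add_apply, coprodR_apply, coprodR_apply, coprodR_apply,
          LinearMap.zero_apply, LinearMap.zero_apply, zero_add, add_zero]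
    rw [h]
    exact add_mem h1 h2⟩
  left_inv f := Subtype.ext (comp_eq_coprodR f.1)
  right_inv p := Prod.ext (Subtype.ext (coprodR_comp_inlR p.1.1 p.2.1))
    (Subtype.ext (coprodR_comp_inrR p.1.1 p.2.1))

theorem pointsProd_symm_apply (f : M.EPoints S) (g : N.EPoints S) (m : (M.prod N).carrier) :
    ((pointsProd M N S).symm (f, g)).1 m = f.1 m.1 + g.1 m.2 := rfl

end Points

/-! ## The exponential of a direct sum -/

section Exponential

variable {k : Type u} [Field k] [Fintype k] {K : IntermediateField (ratTheta k) (Kinf k)}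
  {M N : SigmaModule.{u, u, w} k K}

/-- The direct sum of two maps from Lie algebras to points. -/
def expProd (e : M.LiePoints (Cinf k) →ₗ[k[X]] M.EPoints (Cinf k))
    (f : N.LiePoints (Cinf k) →ₗ[k[X]] N.EPoints (Cinf k)) :
    (M.prod N).LiePoints (Cinf k) →ₗ[k[X]] (M.prod N).EPoints (Cinf k) :=
  (pointsProd M N (Cinf k)).symm.toLinearMap ∘ₗ e.prodMap f ∘ₗ
    (lieProdA M N (Cinf k)).toLinearMap

theorem expProd_apply (e : M.LiePoints (Cinf k) →ₗ[k[X]] M.EPoints (Cinf k))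
    (f : N.LiePoints (Cinf k) →ₗ[k[X]] N.EPoints (Cinf k))
    (ξ : (M.prod N).LiePoints (Cinf k)) (m : (M.prod N).carrier) :
    (expProd e f ξ).1 m = (e (lieProd M N (Cinf k) ξ).1).1 m.1 +
      (f (lieProd M N (Cinf k) ξ).2).1 m.2 := rfl

/-- In concatenated coordinates (x, y) on the Lie algebra, the function attached to m = (m₁, m₂) is
p(x) + p'(y). Each series uses its own block of variables, so convergence and linear parts are
inherited from the summands. -/
theorem IsExponential.prod {e : M.LiePoints (Cinf k) →ₗ[k[X]] M.EPoints (Cinf k)}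
    {f : N.LiePoints (Cinf k) →ₗ[k[X]] N.EPoints (Cinf k)}
    (he : M.IsExponential e) (hf : N.IsExponential f) :
    (M.prod N).IsExponential (expProd e f) := by
  classical
  obtain ⟨d, b, hb⟩ := he
  obtain ⟨d', b', hb'⟩ := hf
  let B : Module.Basis (Fin (d + d')) (Cinf k) ((M.prod N).LiePoints (Cinf k)) :=
    ((b.prod b').map (lieProd M N (Cinf k)).symm).reindex finSumFinEquiv
  have hBl (i : Fin d) : B (Fin.castAddEmb d' i) = (lieProd M N (Cinf k)).symm (b i, 0) := by
    simp [B, Module.Basis.prod_apply]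
  have hBr (i : Fin d') : B (Fin.natAddEmb d i) = (lieProd M N (Cinf k)).symm (0, b' i) := by
    simp [B, Module.Basis.prod_apply]
  have hrl (ξ) (i : Fin d) : B.repr ξ (Fin.castAddEmb d' i) =
      b.repr (lieProd M N (Cinf k) ξ).1 i := by
    simp [B]
  have hrr (ξ) (i : Fin d') : B.repr ξ (Fin.natAddEmb d i) =
      b'.repr (lieProd M N (Cinf k) ξ).2 i := by
    simp [B]
  refine ⟨d + d', B, fun m => ?_⟩
  obtain ⟨p, hp, hp1⟩ := hb m.1
  obtain ⟨p', hp', hp1'⟩ := hb' m.2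
  refine ⟨MvPowerSeries.rename (Fin.castAddEmb d') p + MvPowerSeries.rename (Fin.natAddEmb d) p',
    fun ξ => ?_, fun i => ?_⟩
  · rw [expProd_apply]
    simp only [map_add, add_mul]
    refine HasSum.add ?_ ?_
    · refine MvPowerSeries.hasSum_rename _ p (fun i => B.repr ξ i) ?_
      simp only [hrl]
      exact hp _
    · refine MvPowerSeries.hasSum_rename _ p' (fun i => B.repr ξ i) ?_
      simp only [hrr]
      exact hp' _
  · rw [map_add]
    induction i using Fin.addCases with
    | left i =>
      refine (congrArg₂ (· + ·) (MvPowerSeries.coeff_single_rename (Fin.castAddEmb d') p i)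
        (MvPowerSeries.coeff_single_rename_of_notMem (Fin.natAddEmb d) p' ?_)).trans ?_
      · rintro ⟨j, hj⟩
        have := congrArg Fin.val hj
        simp at this
        omega
      · refine Eq.trans ?_ (congrArg (fun x => x.1 m) (hBl i)).symm
        exact congrArg (· + 0) (hp1 i)
    | right i =>
      refine (congrArg₂ (· + ·) (MvPowerSeries.coeff_single_rename_of_notMem (Fin.castAddEmb d') p ?_)
        (MvPowerSeries.coeff_single_rename (Fin.natAddEmb d) p' i)).trans ?_
      · rintro ⟨j, hj⟩
        have := congrArg Fin.val hj
        simp at this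
        omega
      · refine Eq.trans ?_ (congrArg (fun x => x.1 m) (hBr i)).symm
        exact congrArg (0 + ·) (hp1' i)

theorem Uniformizable.prod (hM : M.Uniformizable) (hN : N.Uniformizable) :
    (M.prod N).Uniformizable := by
  obtain ⟨e, he, hes⟩ := hM
  obtain ⟨f, hf, hfs⟩ := hN
  refine ⟨expProd e f, he.prod hf, ?_⟩
  exact (pointsProd M N (Cinf k)).symm.surjective.comp
    ((hes.prodMap hfs).comp (lieProdA M N (Cinf k)).surjective)

end Exponential

end SigmaModule

end TMotive

end

/-! ### Dual representations and Tate modules of products -/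

noncomputable section

/-- In dual bases the transpose map has the transposed matrix, which has the same reverse
characteristic polynomial; what remains is a block diagonal matrix. -/
theorem charpolyRev_dual_prod {R : Type*} [CommRing R] {U V W : Type*} [AddCommGroup U]
    [Module R U] [AddCommGroup V] [Module R V] [AddCommGroup W] [Module R W] {m n : ℕ}
    (b : Module.Basis (Fin m) R V) (c : Module.Basis (Fin n) R W) (φ : U ≃ₗ[R] V × W)
    (u : U →ₗ[R] U) (f : V →ₗ[R] V) (g : W →ₗ[R] W)
    (h : ∀ x, φ (u x) = (f (φ x).1, g (φ x).2))
    (B : Module.Basis (Fin (m + n)) R U)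
    (hB : B = ((b.prod c).map φ.symm).reindex finSumFinEquiv) :
    (LinearMap.toMatrix B.dualBasis B.dualBasis (Module.Dual.transpose (R := R) u)).charpolyRev =
      (LinearMap.toMatrix b.dualBasis b.dualBasis (Module.Dual.transpose (R := R) f)).charpolyRev *
      (LinearMap.toMatrix c.dualBasis c.dualBasis
        (Module.Dual.transpose (R := R) g)).charpolyRev := by
  rw [LinearMap.toMatrix_transpose, LinearMap.toMatrix_transpose, LinearMap.toMatrix_transpose,
    Matrix.charpolyRev_transpose', Matrix.charpolyRev_transpose', Matrix.charpolyRev_transpose',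
    ← Matrix.charpolyRev_fromBlocks_diagonal, ← Matrix.charpolyRev_reindex' finSumFinEquiv]
  congr 1
  ext i j
  simp only [LinearMap.toMatrix_apply, hB, Matrix.reindex_apply, Matrix.submatrix_apply,
    Module.Basis.repr_reindex_apply, Module.Basis.reindex_apply, Module.Basis.map_repr,
    Module.Basis.map_apply, LinearEquiv.trans_apply, LinearEquiv.symm_symm, h,
    LinearEquiv.apply_symm_apply]
  rcases finSumFinEquiv.symm i with i | i <;> rcases finSumFinEquiv.symm j with j | j <;>
    simp [Module.Basis.prod, LinearMap.toMatrix_apply]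

/-- Scalar extension of a decomposition into a product. -/
def baseChangeProdEquiv {A : Type*} (B : Type*) [CommRing A] [CommRing B] [Algebra A B]
    {U V W : Type*} [AddCommGroup U] [Module A U] [AddCommGroup V] [Module A V] [AddCommGroup W]
    [Module A W] (φ : U ≃ₗ[A] V × W) : B ⊗[A] U ≃ₗ[B] (B ⊗[A] V) × (B ⊗[A] W) :=
  (φ.baseChange A B _ _).trans (TensorProduct.prodRight A B B V W)

/-- The basis `d` is chosen before `g`, because one basis must serve all Frobenius elements in
`IsDualEulerFactor`. -/
theorem exists_basis_charpolyRev_dual_prod {A B : Type*} [CommRing A] [CommRing B] [Algebra A B]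
    {G U V W : Type*} [Group G] [AddCommGroup U] [Module A U] [AddCommGroup V] [Module A V]
    [AddCommGroup W] [Module A W] (φ : U ≃ₗ[A] V × W)
    (ρU : Representation A G U) (ρV : Representation A G V) (ρW : Representation A G W)
    (h : ∀ g x, φ (ρU g x) = (ρV g (φ x).1, ρW g (φ x).2)) {m n : ℕ}
    (b : Module.Basis (Fin m) B (B ⊗[A] V)) (c : Module.Basis (Fin n) B (B ⊗[A] W)) :
    ∃ d : Module.Basis (Fin (m + n)) B (B ⊗[A] U), ∀ g,
      (LinearMap.toMatrix d.dualBasis d.dualBasis (Representation.dual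
        (((Module.End.baseChangeHom A B U : Module.End A U →* _)).comp ρU) g)).charpolyRev =
      (LinearMap.toMatrix b.dualBasis b.dualBasis (Representation.dual
        (((Module.End.baseChangeHom A B V : Module.End A V →* _)).comp ρV) g)).charpolyRev *
      (LinearMap.toMatrix c.dualBasis c.dualBasis (Representation.dual
        (((Module.End.baseChangeHom A B W : Module.End A W →* _)).comp ρW) g)).charpolyRev := by
  -- The dual representation at `g` is the transpose of the action of `g⁻¹`.
  refine ⟨_, fun g => charpolyRev_dual_prod b c (baseChangeProdEquiv B φ)
    ((ρU g⁻¹).baseChange B) ((ρV g⁻¹).baseChange B) ((ρW g⁻¹).baseChange B) (fun x => ?_) _ rfl⟩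
  induction x using TensorProduct.induction_on with
  | zero => simp only [map_zero]; rfl
  | tmul a m =>
    exact Prod.ext (congrArg (fun y : V × W => a ⊗ₜ[A] y.1) (h g⁻¹ m))
      (congrArg (fun y : V × W => a ⊗ₜ[A] y.2) (h g⁻¹ m))
  | add x y hx hy => simp only [map_add, hx, hy, Prod.fst_add, Prod.snd_add, Prod.mk_add_mk]

/-- Needed so that the relation "sum of the two projectors is the identity" survives completion. -/
theorem AdicCompletion.map_add_apply {R : Type*} [CommRing R] (I : Ideal R) {M N : Type*}
    [AddCommGroup M] [Module R M] [AddCommGroup N] [Module R N] (f g : M →ₗ[R] N)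
    (x : AdicCompletion I M) :
    AdicCompletion.map I (f + g) x = AdicCompletion.map I f x + AdicCompletion.map I g x := by
  have h : ⇑(AdicCompletion.map I (f + g)) =
      ⇑(AdicCompletion.map I f + AdicCompletion.map I g) := by
    refine AdicCompletion.map_ext I fun a => ?_
    rw [LinearMap.add_apply, map_mk, map_mk, map_mk, ← map_add]
    rfl
  exact congrFun h x

namespace TMotive

namespace SigmaModule

/-! ## Functoriality of Tate modules -/

section Tate

variable {k : Type u} [Field k] [Fintype k] {K : Type v} [Field K] [Algebra k K]
  {M N P : SigmaModule.{u, v, w} k K}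

/-- The map of `A`-modules induced on `M_{K^sep}`. -/
def sepMap (f : M.carrier →ₗ[K[X]] N.carrier) : M.sep.carrier →ₗ[k[X]] N.sep.carrier where
  toFun := f.baseChange (SeparableClosure K)[X]
  map_add' := map_add _
  map_smul' a x := (f.baseChange (SeparableClosure K)[X]).map_smul
    (a.map (algebraMap k (SeparableClosure K))) x

theorem sepMap_comp (g : N.carrier →ₗ[K[X]] P.carrier) (f : M.carrier →ₗ[K[X]] N.carrier) :
    sepMap (g ∘ₗ f) = sepMap g ∘ₗ sepMap f :=
  LinearMap.ext fun x => LinearMap.congr_fun (LinearMap.baseChange_comp f g) x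

theorem sepMap_id : sepMap (LinearMap.id : M.carrier →ₗ[K[X]] M.carrier) = LinearMap.id :=
  LinearMap.ext fun x => LinearMap.congr_fun LinearMap.baseChange_id x

theorem sepMap_add (f g : M.carrier →ₗ[K[X]] N.carrier) :
    sepMap (f + g) = sepMap f + sepMap g :=
  LinearMap.ext fun x => LinearMap.congr_fun (LinearMap.baseChange_add f g) x

theorem sepMap_zero : sepMap (0 : M.carrier →ₗ[K[X]] N.carrier) = 0 :=
  LinearMap.ext fun x => LinearMap.congr_fun LinearMap.baseChange_zero x

theorem sepMap_sigmaA (f : M.carrier →ₗ[K[X]] N.carrier) (hf : ∀ m, f (M.σ m) = N.σ (f m)) :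
    sepMap f ∘ₗ M.sep.sigmaA = N.sep.sigmaA ∘ₗ sepMap f := by
  refine LinearMap.ext fun x => ?_
  induction x using TensorProduct.induction_on with
  | zero => exact (map_zero _).trans (map_zero _).symm
  | tmul a m => exact congrArg (_ ⊗ₜ[K[X]] ·) (hf m)
  | add x y hx hy =>
    exact (map_add _ x y).trans ((congrArg₂ _ hx hy).trans (map_add _ x y).symm)

theorem sepMap_galSep (f : M.carrier →ₗ[K[X]] N.carrier) (g : GalK K) :
    sepMap f ∘ₗ M.galSep g = N.galSep g ∘ₗ sepMap f := by
  refine LinearMap.ext fun x => ?_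
  induction x using TensorProduct.induction_on with
  | zero => exact (map_zero _).trans (map_zero _).symm
  | tmul a m => rfl
  | add x y hx hy =>
    exact (map_add _ x y).trans ((congrArg₂ _ hx hy).trans (map_add _ x y).symm)

variable (l : Ideal k[X])

/-- Functoriality of the Tate module. -/
def tateMap (f : M.carrier →ₗ[K[X]] N.carrier) (hf : ∀ m, f (M.σ m) = N.σ (f m)) :
    M.tateModule l →ₗ[AdicCompletion l k[X]] N.tateModule l :=
  (AdicCompletion.map l (sepMap f)).restrict (fun x hx => by
    have hx' : AdicCompletion.map l M.sep.sigmaA x = x := by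
      simpa [tateModule, sub_eq_zero] using hx
    have h : AdicCompletion.map l N.sep.sigmaA (AdicCompletion.map l (sepMap f) x) =
        AdicCompletion.map l (sepMap f) x := by
      rw [AdicCompletion.map_comp_apply, ← sepMap_sigmaA f hf, ← AdicCompletion.map_comp_apply,
        hx']
    simpa [tateModule, sub_eq_zero] using h)

theorem tateMap_tateRep (f : M.carrier →ₗ[K[X]] N.carrier) (hf : ∀ m, f (M.σ m) = N.σ (f m))
    (g : GalK K) (x : M.tateModule l) :
    tateMap l f hf (M.tateRep l g x) = N.tateRep l g (tateMap l f hf x) := by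
  refine Subtype.ext ?_
  change AdicCompletion.map l (sepMap f) (AdicCompletion.map l (M.galSep g) x.1) =
    AdicCompletion.map l (N.galSep g) (AdicCompletion.map l (sepMap f) x.1)
  rw [AdicCompletion.map_comp_apply, AdicCompletion.map_comp_apply, sepMap_galSep]

variable (M N)

/-- The inclusion of the first summand. -/
def inlP : M.carrier →ₗ[K[X]] (M.prod N).carrier := LinearMap.inl K[X] M.carrier N.carrier

/-- The inclusion of the second summand. -/
def inrP : N.carrier →ₗ[K[X]] (M.prod N).carrier := LinearMap.inr K[X] M.carrier N.carrier

/-- The projection to the first summand. -/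
def fstP : (M.prod N).carrier →ₗ[K[X]] M.carrier := LinearMap.fst K[X] M.carrier N.carrier

/-- The projection to the second summand. -/
def sndP : (M.prod N).carrier →ₗ[K[X]] N.carrier := LinearMap.snd K[X] M.carrier N.carrier

theorem map_sepMap_comp {M N P : SigmaModule.{u, v, w} k K} (g : N.carrier →ₗ[K[X]] P.carrier)
    (f : M.carrier →ₗ[K[X]] N.carrier) (x : AdicCompletion l M.sep.carrier) :
    AdicCompletion.map l (sepMap g) (AdicCompletion.map l (sepMap f) x) =
      AdicCompletion.map l (sepMap (g ∘ₗ f)) x := by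
  rw [AdicCompletion.map_comp_apply, sepMap_comp]

theorem map_sepMap_id (x : AdicCompletion l M.sep.carrier) :
    AdicCompletion.map l (sepMap (LinearMap.id : M.carrier →ₗ[K[X]] M.carrier)) x = x := by
  rw [sepMap_id]
  exact LinearMap.congr_fun (AdicCompletion.map_id l M.sep.carrier) x

theorem map_sepMap_zero (x : AdicCompletion l M.sep.carrier) :
    AdicCompletion.map l (sepMap (0 : M.carrier →ₗ[K[X]] N.carrier)) x = 0 := by
  rw [sepMap_zero]
  exact LinearMap.congr_fun (AdicCompletion.map_zero l) x

/-- The Tate module of a direct sum. -/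
def tateProd : (M.prod N).tateModule l ≃ₗ[AdicCompletion l k[X]]
    M.tateModule l × N.tateModule l :=
  LinearEquiv.ofLinearMap
    ((tateMap l (fstP M N) fun _ => rfl).prod (tateMap l (sndP M N) fun _ => rfl))
    ((tateMap l (inlP M N) fun _ => Prod.ext rfl (map_zero N.σ).symm).coprod
      (tateMap l (inrP M N) fun _ => Prod.ext (map_zero M.σ).symm rfl))
    (by
      -- The inclusions and projections satisfy the biproduct relations, and these are preserved
      -- because base change and completion are additive functors.
      have h11 : fstP M N ∘ₗ inlP M N = LinearMap.id := rfl
      have h12 : fstP M N ∘ₗ inrP M N = 0 := rfl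
      have h21 : sndP M N ∘ₗ inlP M N = 0 := rfl
      have h22 : sndP M N ∘ₗ inrP M N = LinearMap.id := rfl
      refine LinearMap.ext fun x => Prod.ext (Subtype.ext ?_) (Subtype.ext ?_)
      · change AdicCompletion.map l (sepMap (fstP M N))
          (AdicCompletion.map l (sepMap (inlP M N)) x.1.1 +
            AdicCompletion.map l (sepMap (inrP M N)) x.2.1) = x.1.1
        rw [map_add, map_sepMap_comp, map_sepMap_comp, h11, h12, map_sepMap_id, map_sepMap_zero,
          add_zero]
      · change AdicCompletion.map l (sepMap (sndP M N))
          (AdicCompletion.map l (sepMap (inlP M N)) x.1.1 +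
            AdicCompletion.map l (sepMap (inrP M N)) x.2.1) = x.2.1
        rw [map_add, map_sepMap_comp, map_sepMap_comp, h21, h22, map_sepMap_id, map_sepMap_zero,
          zero_add])
    (by
      have h : inlP M N ∘ₗ fstP M N + inrP M N ∘ₗ sndP M N = LinearMap.id :=
        LinearMap.ext fun m => Prod.ext (add_zero m.1) (zero_add m.2)
      refine LinearMap.ext fun x => Subtype.ext ?_
      change AdicCompletion.map l (sepMap (inlP M N))
          (AdicCompletion.map l (sepMap (fstP M N)) x.1) +
        AdicCompletion.map l (sepMap (inrP M N))
          (AdicCompletion.map l (sepMap (sndP M N)) x.1) = x.1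
      rw [map_sepMap_comp, map_sepMap_comp, ← AdicCompletion.map_add_apply, ← sepMap_add, h,
        map_sepMap_id])

theorem tateProd_tateRep (g : GalK K) (x : (M.prod N).tateModule l) :
    tateProd M N l ((M.prod N).tateRep l g x) =
      (M.tateRep l g (tateProd M N l x).1, N.tateRep l g (tateProd M N l x).2) :=
  Prod.ext (tateMap_tateRep l _ _ g x) (tateMap_tateRep l _ _ g x)

end Tate

end SigmaModule

end TMotive

end

noncomputable section

namespace TMotive

namespace SigmaModule

/-! ## The `L`-value of a direct sum -/

section LValue

variable {k : Type u} [Field k] [Fintype k] {K : IntermediateField (ratTheta k) (Kinf k)}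
  {M N : SigmaModule.{u, u, w} k K}

theorem IsDualEulerFactor.prod {v : FinitePlace k K} {P Q : (RatFunc k)[X]}
    (hP : M.IsDualEulerFactor v P) (hQ : N.IsDualEulerFactor v Q) :
    (M.prod N).IsDualEulerFactor v (P * Q) := by
  intro l hl h0 hv
  have h1 := hP l hl h0 hv
  have h2 := hQ l hl h0 hv
  obtain ⟨r, b, hb⟩ := h1
  obtain ⟨s, c, hc⟩ := h2
  have h3 := exists_basis_charpolyRev_dual_prod (B := FLambda k l) (tateProd M N l)
    ((M.prod N).tateRep l) (M.tateRep l) (N.tateRep l) (tateProd_tateRep M N l) b c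
  obtain ⟨d, hd⟩ := h3
  refine ⟨r + s, d, fun g hg => ?_⟩
  exact (Polynomial.map_mul _).trans
    ((congrArg₂ (· * ·) (hb g hg) (hc g hg)).trans (hd g).symm)

/-- Both Euler products converge unconditionally, hence so does their termwise product, to the
product of the limits. -/
theorem HasDualLValue.prod {L L' : Kinf k} (hM : M.HasDualLValue L) (hN : N.HasDualLValue L') :
    (M.prod N).HasDualLValue (L * L') := by
  obtain ⟨P, hP, hPL⟩ := hM
  obtain ⟨Q, hQ, hQL⟩ := hN
  refine ⟨fun v => P v * Q v, fun v => (hP v).prod (hQ v), ?_⟩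
  convert hPL.mul hQL using 2 with v
  rw [Polynomial.eval_mul, map_mul, mul_inv]

end LValue

end SigmaModule

end TMotive

end

/-! ### Ranks over a domain and lattices in coordinates -/

noncomputable section

/-- This is rank-nullity for the first projection, valid over a domain without freeness or
finiteness; the submodules `Z` of the conjecture are not assumed to have either property. -/
theorem rank_prod_of_isDomain {R : Type u} [CommRing R] [IsDomain R] {V W : Type w}
    [AddCommGroup V] [Module R V] [AddCommGroup W] [Module R W] :
    Module.rank R (V × W) = Module.rank R V + Module.rank R W := by
  rw [LinearMap.rank_eq_of_surjective (f := LinearMap.fst R V W) LinearMap.fst_surjective]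
  congr 1
  rw [← LinearMap.range_inr]
  exact (LinearEquiv.ofInjective _ LinearMap.inr_injective).symm.rank_eq

section Lattice

variable {A R : Type*} [CommRing A] [CommRing R] [Algebra A R] {V : Type*} [AddCommGroup V]
  [Module R V] {n : ℕ} [Module A (⋀[R]^n V)] [IsScalarTower A R (⋀[R]^n V)]

theorem map_span_ιMulti (b : Module.Basis (Fin n) R V) (S : Set V) :
    (Submodule.span A {x | ∃ s : Fin n → V, (∀ i, s i ∈ S) ∧
      exteriorPower.ιMulti R n s = x}).map
        ((exteriorPowerTopEquiv b).toLinearMap.restrictScalars A) = detSpan A b S := by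
  rw [Submodule.map_span, detSpan]
  congr 1
  ext x
  constructor
  · rintro ⟨_, ⟨s, hs, rfl⟩, rfl⟩
    exact ⟨s, hs, (exteriorPowerTopEquiv_ιMulti b s).symm⟩
  · rintro ⟨s, hs, rfl⟩
    exact ⟨_, ⟨s, hs, rfl⟩, exteriorPowerTopEquiv_ιMulti b s⟩

/-- An identity between subsets of an exterior power becomes one between `A`-submodules of the ring
`R`, where two such identities can be multiplied. -/
theorem coe_eq_smul_image_iff (b : Module.Basis (Fin n) R V) (P Q : Submodule A (⋀[R]^n V))
    (L : R) :
    (P : Set (⋀[R]^n V)) = (fun x => L • x) '' (Q : Set (⋀[R]^n V)) ↔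
      P.map ((exteriorPowerTopEquiv b).toLinearMap.restrictScalars A) =
        Submodule.span A {L} *
          Q.map ((exteriorPowerTopEquiv b).toLinearMap.restrictScalars A) := by
  rw [← (exteriorPowerTopEquiv b).injective.image_injective.eq_iff]
  refine Iff.trans ?_ SetLike.coe_set_eq
  refine Eq.congr rfl ?_
  ext x
  rw [SetLike.mem_coe, Submodule.mem_span_singleton_mul]
  constructor
  · rintro ⟨_, ⟨y, hy, rfl⟩, rfl⟩
    exact ⟨_, ⟨y, hy, rfl⟩, (map_smul (exteriorPowerTopEquiv b) L y).symm⟩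
  · rintro ⟨_, ⟨y, hy, rfl⟩, rfl⟩
    exact ⟨_, ⟨y, hy, rfl⟩, map_smul (exteriorPowerTopEquiv b) L y⟩

end Lattice

namespace TMotive

namespace SigmaModule

/-! ## Lattices in the top exterior power -/

section Lattice

variable {k : Type u} [Field k] [Fintype k] {K : IntermediateField (ratTheta k) (Kinf k)}
  {M N : SigmaModule.{u, u, w} k K}

theorem wedgeLattice_eq_smul_iff {n : ℕ} (b : Module.Basis (Fin n) (Kinf k) M.WInf)
    (S T : Set M.WInf) (L : Kinf k) :
    (M.wedgeLattice n S : Set (⋀[Kinf k]^n M.WInf)) =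
        (fun x => L • x) '' (M.wedgeLattice n T : Set (⋀[Kinf k]^n M.WInf)) ↔
      detSpan (Algebra.adjoin k {theta k}) b S =
        Submodule.span (Algebra.adjoin k {theta k}) {L} *
          detSpan (Algebra.adjoin k {theta k}) b T :=
  (coe_eq_smul_image_iff b _ _ L).trans
    (Eq.congr (map_span_ιMulti b S) (congrArg (_ * ·) (map_span_ιMulti b T)))

end Lattice

section FiniteLie

variable {k : Type u} [Field k] [Fintype k] {R : Type v} [CommRing R] [Algebra k R]
  {M : SigmaModule.{u, v, w} k R}

/-- A tangent vector ξ is determined by its values on the τ-generators: its kernel contains σ(M),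
hence is σ-stable, and so is everything once it contains the generators. -/
theorem FiniteOverTau.finite_lie (hM : M.FiniteOverTau) (S : Type*) [Field S] [Algebra R S] :
    Module.Finite S (M.LiePoints S) := by
  obtain ⟨s, hs⟩ := hM
  let f : M.LiePoints S →ₗ[S] (s → S) :=
    { toFun := fun ξ m => ξ.1 m
      map_add' := fun _ _ => rfl
      map_smul' := fun _ _ => rfl }
  refine Module.Finite.of_injective f ((injective_iff_map_eq_zero f).mpr fun ξ hξ => ?_)
  have h : LinearMap.ker ξ.1 = ⊤ :=
    hs _ (fun m hm => congrFun hξ ⟨m, hm⟩) fun m _ => ξ.2 m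
  exact Subtype.ext (LinearMap.ker_eq_top.mp h)

end FiniteLie

/-! ## The space `W_E` of a direct sum -/

section WProd

variable {k : Type u} [Field k] [Fintype k] {K : IntermediateField (ratTheta k) (Kinf k)}
  (M N : SigmaModule.{u, u, w} k K)

theorem w_surjective : Function.Surjective M.w := Submodule.mkQ_surjective _

theorem lieProd_tLie (ξ : (M.prod N).LiePoints (Kinf k)) :
    lieProd M N (Kinf k) ((M.prod N).tLie (Kinf k) ξ) =
      (M.tLie (Kinf k) (lieProd M N (Kinf k) ξ).1, N.tLie (Kinf k) (lieProd M N (Kinf k) ξ).2) :=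
  lieProd_smul M N (Kinf k) X ξ

/-- Since t acts componentwise, so does t - θ, and its range is the product of the two ranges.
Written as a kernel, this feeds the first isomorphism theorem in `wProd`. -/
theorem ker_w_prodMap :
    LinearMap.range ((M.prod N).tLie (Kinf k) - theta k •
        (LinearMap.id : (M.prod N).LiePoints (Kinf k) →ₗ[Kinf k] _)) =
      LinearMap.ker ((M.w.prodMap N.w) ∘ₗ (lieProd M N (Kinf k)).toLinearMap) := by
  ext ξ
  rw [LinearMap.mem_ker, LinearMap.mem_range]
  have hM (η : M.LiePoints (Kinf k)) : M.w η = 0 ↔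
      ∃ y, (M.tLie (Kinf k) - theta k • (LinearMap.id : M.LiePoints (Kinf k) →ₗ[Kinf k] _)) y = η := Submodule.Quotient.mk_eq_zero _
  have hN (η : N.LiePoints (Kinf k)) : N.w η = 0 ↔
      ∃ y, (N.tLie (Kinf k) - theta k • (LinearMap.id : N.LiePoints (Kinf k) →ₗ[Kinf k] _)) y = η := Submodule.Quotient.mk_eq_zero _
  have key (y : (M.prod N).LiePoints (Kinf k)) :
      lieProd M N (Kinf k) (((M.prod N).tLie (Kinf k) - theta k •
        (LinearMap.id : (M.prod N).LiePoints (Kinf k) →ₗ[Kinf k] _)) y) =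
        ((M.tLie (Kinf k) - theta k • (LinearMap.id : M.LiePoints (Kinf k) →ₗ[Kinf k] _)) (lieProd M N (Kinf k) y).1,
          (N.tLie (Kinf k) - theta k • (LinearMap.id : N.LiePoints (Kinf k) →ₗ[Kinf k] _)) (lieProd M N (Kinf k) y).2) := by
    rw [LinearMap.sub_apply, map_sub, lieProd_tLie]
    rfl
  constructor
  · rintro ⟨y, rfl⟩
    refine Prod.ext ((hM _).mpr ⟨(lieProd M N (Kinf k) y).1, ?_⟩)
      ((hN _).mpr ⟨(lieProd M N (Kinf k) y).2, ?_⟩)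
    · exact (congrArg Prod.fst (key y)).symm
    · exact (congrArg Prod.snd (key y)).symm
  · intro h
    obtain ⟨y, hy⟩ := (hM _).mp (congrArg Prod.fst h)
    obtain ⟨z, hz⟩ := (hN _).mp (congrArg Prod.snd h)
    refine ⟨(lieProd M N (Kinf k)).symm (y, z), (lieProd M N (Kinf k)).injective ?_⟩
    rw [key, LinearEquiv.apply_symm_apply]
    exact Prod.ext hy hz

/-- The space `W_E` of a direct sum. -/
def wProd : (M.prod N).WInf ≃ₗ[Kinf k] M.WInf × N.WInf :=
  (Submodule.quotEquivOfEq _ _ (ker_w_prodMap M N)).trans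
    (LinearMap.quotKerEquivOfSurjective _
      ((M.w_surjective.prodMap N.w_surjective).comp (lieProd M N (Kinf k)).surjective))

theorem wProd_w (ξ : (M.prod N).LiePoints (Kinf k)) :
    wProd M N ((M.prod N).w ξ) =
      (M.w (lieProd M N (Kinf k) ξ).1, N.w (lieProd M N (Kinf k) ξ).2) := rfl

variable {M N}

/-- The image under `w` of a set of pairs. -/
theorem wProd_symm_preimage_image {Y : Set ((M.prod N).LiePoints (Kinf k))}
    {Y₁ : Set (M.LiePoints (Kinf k))} {Y₂ : Set (N.LiePoints (Kinf k))}
    (hY : ∀ ξ, ξ ∈ Y ↔ (lieProd M N (Kinf k) ξ).1 ∈ Y₁ ∧ (lieProd M N (Kinf k) ξ).2 ∈ Y₂) :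
    (wProd M N).symm ⁻¹' ((M.prod N).w '' Y) = (M.w '' Y₁) ×ˢ (N.w '' Y₂) := by
  ext x
  constructor
  · rintro ⟨ξ, hξ, hx⟩
    have h : x = wProd M N ((M.prod N).w ξ) := by rw [hx, LinearEquiv.apply_symm_apply]
    rw [h, wProd_w]
    exact ⟨⟨_, ((hY ξ).mp hξ).1, rfl⟩, ⟨_, ((hY ξ).mp hξ).2, rfl⟩⟩
  · rintro ⟨⟨y, hy, hyx⟩, ⟨z, hz, hzx⟩⟩
    refine ⟨(lieProd M N (Kinf k)).symm (y, z), (hY _).mpr ?_, ?_⟩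
    · rw [LinearEquiv.apply_symm_apply]
      exact ⟨hy, hz⟩
    · rw [LinearEquiv.eq_symm_apply, wProd_w, LinearEquiv.apply_symm_apply]
      exact Prod.ext hyx hzx

end WProd

end SigmaModule

end TMotive

end

noncomputable section

namespace TMotive

namespace SigmaModule

/-! ## Integral structures of a direct sum -/

section Integral

variable {k : Type u} [Field k] [Fintype k] {K : IntermediateField (ratTheta k) (Kinf k)}
  {M N : SigmaModule.{u, u, w} k K}

theorem GoodModel.α_prod (P : M.GoodModel) (Q : N.GoodModel) (m : (P.model.prod Q.model).carrier) :
    (P.prod Q).α ((P.prod Q).model.toBaseChange K m) =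
      inlR M N (P.α (P.model.toBaseChange K m.1)) + inrR M N (Q.α (Q.model.toBaseChange K m.2)) :=
  (inlR_add_inrR M N _).symm

theorem GoodModel.α_zero (P : M.GoodModel) : P.α (P.model.toBaseChange K 0) = 0 := by
  have h : P.model.toBaseChange K 0 = 0 := TensorProduct.tmul_zero _ _
  rw [h, map_zero]

/-- One inclusion is enough for E, of which the conjecture asks only exp(Z) ⊂ E(O_K). The Lie
algebra needs both, as W_E(O_K) enters through an equality. -/
theorem GoodModel.integralE_prod (P : M.GoodModel) (Q : N.GoodModel) {f : M.EPoints K}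
    {g : N.EPoints K} (hf : f ∈ P.integralE) (hg : g ∈ Q.integralE) :
    (pointsProd M N K).symm (f, g) ∈ (P.prod Q).integralE := by
  obtain ⟨a, ha⟩ := hf
  obtain ⟨b, hb⟩ := hg
  refine ⟨(pointsProd P.model Q.model (OK k K)).symm (a, b), fun m => ?_⟩
  refine (pointsProd_symm_apply M N K f g _).trans ?_
  refine (congrArg₂ (· + ·) (ha m.1) (hb m.2)).trans ?_
  exact (map_add (algebraMap (OK k K) K) (a.1 m.1) (b.1 m.2)).symm

theorem GoodModel.mem_integralLie_prod (P : M.GoodModel) (Q : N.GoodModel)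
    (ξ : (M.prod N).LiePoints K) :
    ξ ∈ (P.prod Q).integralLie ↔
      (lieProd M N K ξ).1 ∈ P.integralLie ∧ (lieProd M N K ξ).2 ∈ Q.integralLie := by
  constructor
  · rintro ⟨g, hg⟩
    refine ⟨⟨(lieProd P.model Q.model (OK k K) g).1, fun m => ?_⟩,
      ⟨(lieProd P.model Q.model (OK k K) g).2, fun m => ?_⟩⟩
    · refine (congrArg ξ.1 ?_).trans (hg (inlR P.model Q.model m))
      exact Prod.ext rfl Q.α_zero.symm
    · refine (congrArg ξ.1 ?_).trans (hg (inrR P.model Q.model m))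
      exact Prod.ext P.α_zero.symm rfl
  · rintro ⟨⟨a, ha⟩, ⟨b, hb⟩⟩
    refine ⟨(lieProd P.model Q.model (OK k K)).symm (a, b), fun m => ?_⟩
    refine (congrArg ξ.1 (α_prod P Q m)).trans ((map_add ξ.1 _ _).trans ?_)
    refine (congrArg₂ (· + ·) (ha m.1) (hb m.2)).trans ?_
    exact (map_add (algebraMap (OK k K) K) (a.1 m.1) (b.1 m.2)).symm

/-- Supplies the zero vector required by `detSpan_prod`. -/
theorem GoodModel.zero_mem_integralW (P : M.GoodModel) : (0 : M.WInf) ∈ P.integralW := by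
  refine ⟨0, ⟨0, fun m => (map_zero (algebraMap (OK k K) K)).symm⟩, ?_⟩
  have h : M.lieMap (IsScalarTower.toAlgHom K K (Kinf k)) 0 = 0 :=
    Subtype.ext (LinearMap.ext fun m => map_zero (IsScalarTower.toAlgHom K K (Kinf k)))
  exact (congrArg M.w h).trans (map_zero _)

/-- `integralW` is an image from the Lie algebra over K, not over K_∞, so
`wProd_symm_preimage_image` does not apply directly; the splitting of Lie must also commute with
extension from K to K_∞. -/
theorem GoodModel.integralW_prod (P : M.GoodModel) (Q : N.GoodModel) :
    (wProd M N).symm ⁻¹' (P.prod Q).integralW = P.integralW ×ˢ Q.integralW := by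
  ext x
  constructor
  · rintro ⟨ξ, hξ, hx⟩
    have h := (LinearEquiv.symm_apply_eq _).mp hx.symm
    rw [wProd_w] at h
    obtain ⟨h1, h2⟩ := (mem_integralLie_prod P Q ξ).mp hξ
    rw [h]
    exact ⟨⟨_, h1, rfl⟩, ⟨_, h2, rfl⟩⟩
  · rintro ⟨⟨y, hy, hyx⟩, ⟨z, hz, hzx⟩⟩
    refine ⟨(lieProd M N K).symm (y, z), (mem_integralLie_prod P Q _).mpr ?_, ?_⟩
    · rw [LinearEquiv.apply_symm_apply]
      exact ⟨hy, hz⟩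
    · refine (LinearEquiv.eq_symm_apply _).mpr ?_
      have h : lieProd M N (Kinf k) ((M.prod N).lieMap (IsScalarTower.toAlgHom K K (Kinf k))
          ((lieProd M N K).symm (y, z))) =
          (M.lieMap (IsScalarTower.toAlgHom K K (Kinf k)) y,
            N.lieMap (IsScalarTower.toAlgHom K K (Kinf k)) z) := by
        have h2 := LinearEquiv.apply_symm_apply (lieProd M N K) (y, z)
        exact congrArg (fun p : M.LiePoints K × N.LiePoints K =>
          (M.lieMap (IsScalarTower.toAlgHom K K (Kinf k)) p.1,
            N.lieMap (IsScalarTower.toAlgHom K K (Kinf k)) p.2)) h2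
      exact (wProd_w M N _).trans
        ((congrArg (fun p => (M.w p.1, N.w p.2)) h).trans (Prod.ext hyx hzx))

end Integral

end SigmaModule

end TMotive

end

/-! ### Products of submodules and the conjecture -/

noncomputable section

/-- A product of submodules is the product of the submodules. -/
def submoduleProdEquiv {R V W : Type*} [Semiring R] [AddCommMonoid V] [Module R V]
    [AddCommMonoid W] [Module R W] (P : Submodule R V) (Q : Submodule R W) :
    P.prod Q ≃ₗ[R] P × Q where
  toFun x := (⟨x.1.1, x.2.1⟩, ⟨x.1.2, x.2.2⟩)
  map_add' _ _ := rfl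
  map_smul' _ _ := rfl
  invFun x := ⟨(x.1.1, x.2.1), x.1.2, x.2.2⟩
  left_inv _ := rfl
  right_inv _ := rfl

theorem mul_eq_span_singleton_mul {A R : Type*} [CommRing A] [CommRing R] [Algebra A R]
    {P₁ P₂ Q₁ Q₂ : Submodule A R} {x y : R} (h₁ : P₁ = Submodule.span A {x} * Q₁)
    (h₂ : P₂ = Submodule.span A {y} * Q₂) :
    P₁ * P₂ = Submodule.span A {x * y} * (Q₁ * Q₂) := by
  rw [h₁, h₂, mul_mul_mul_comm, Submodule.span_mul_span, Set.singleton_mul_singleton]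

namespace TMotive

namespace SigmaModule

/-! ## The conjecture for a direct sum -/

section Conjecture

variable {k : Type u} [Field k] [Fintype k] {K : IntermediateField (ratTheta k) (Kinf k)}
  {M N : SigmaModule.{u, u, w} k K}

theorem FiniteOverTau.finite_WInf (hM : M.FiniteOverTau) : Module.Finite (Kinf k) M.WInf :=
  have := hM.finite_lie (Kinf k)
  Module.Finite.of_surjective M.w M.w_surjective

/-- Finiteness matters: `Module.finrank` is 0 by default on an infinite-dimensional space and would
not add. -/
theorem finrank_WInf_prod (hM : M.FiniteOverTau) (hN : N.FiniteOverTau) :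
    Module.finrank (Kinf k) (M.prod N).WInf =
      Module.finrank (Kinf k) M.WInf + Module.finrank (Kinf k) N.WInf := by
  have := hM.finite_WInf
  have := hN.finite_WInf
  rw [(wProd M N).finrank_eq, Module.finrank_prod]

/-- The submodule of pairs in the Lie algebra of a direct sum. -/
def lieSubmoduleProd (Z₁ : Submodule k[X] (M.LiePoints (Kinf k)))
    (Z₂ : Submodule k[X] (N.LiePoints (Kinf k))) :
    Submodule k[X] ((M.prod N).LiePoints (Kinf k)) :=
  (Z₁.prod Z₂).comap (lieProdA M N (Kinf k)).toLinearMap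

theorem rank_lieSubmoduleProd (Z₁ : Submodule k[X] (M.LiePoints (Kinf k)))
    (Z₂ : Submodule k[X] (N.LiePoints (Kinf k))) :
    Module.rank k[X] (lieSubmoduleProd Z₁ Z₂) = Module.rank k[X] Z₁ + Module.rank k[X] Z₂ := by
  rw [← rank_prod_of_isDomain]
  exact (((lieProdA M N (Kinf k)).ofSubmodule' (Z₁.prod Z₂)).trans
    (submoduleProdEquiv Z₁ Z₂)).rank_eq

theorem ConjectureHolds.prod (hfM : M.FiniteOverTau) (hfN : N.FiniteOverTau)
    (hM : M.ConjectureHolds) (hN : N.ConjectureHolds) : (M.prod N).ConjectureHolds := by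
  obtain ⟨P, e, L, Z, he, hL, hZ, hZe, hZL⟩ := hM
  obtain ⟨Q, f, L', Z', hf, hL', hZ', hZe', hZL'⟩ := hN
  refine ⟨P.prod Q, expProd e f, L * L', lieSubmoduleProd Z Z', he.prod hf, hL.prod hL', ?_, ?_, ?_⟩
  · rw [rank_lieSubmoduleProd, hZ, hZ', finrank_WInf_prod hfM hfN, Nat.cast_add]
  · intro z hz
    obtain ⟨a, ha, haz⟩ := hZe _ hz.1
    obtain ⟨b, hb, hbz⟩ := hZe' _ hz.2
    refine ⟨_, P.integralE_prod Q ha hb, Subtype.ext (LinearMap.ext fun m => ?_)⟩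
    refine (expProd_apply e f _ m).trans ?_
    refine (congrArg₂ (· + ·) (congrArg (fun x => x.1 m.1) haz)
      (congrArg (fun x => x.1 m.2) hbz)).trans ?_
    exact (map_add (IsScalarTower.toAlgHom K K (Cinf k)) (a.1 m.1) (b.1 m.2)).symm
  · have := hfM.finite_WInf
    have := hfN.finite_WInf
    let b := Module.finBasis (Kinf k) M.WInf
    let c := Module.finBasis (Kinf k) N.WInf
    have hb := (wedgeLattice_eq_smul_iff b _ _ _).mp hZL
    have hc := (wedgeLattice_eq_smul_iff c _ _ _).mp hZL'
    -- The dimension of W of the sum equals the sum of the dimensions only by a theorem, so the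
    -- product basis has to be reindexed along that equality.
    let e : Fin _ ⊕ Fin _ ≃ Fin (Module.finrank (Kinf k) (M.prod N).WInf) :=
      finSumFinEquiv.trans (finCongr (finrank_WInf_prod hfM hfN).symm)
    refine (wedgeLattice_eq_smul_iff (((b.prod c).map (wProd M N).symm).reindex e) _ _ _).mpr ?_
    have h1 := detSpan_reindex_map_prod (A := Algebra.adjoin k {theta k}) b c (wProd M N).symm e
      (wProd_symm_preimage_image (Y := (lieSubmoduleProd Z Z' : Set _)) (Y₁ := (Z : Set _))
        (Y₂ := (Z' : Set _)) fun ξ => Iff.rfl)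
      ⟨0, Z.zero_mem, map_zero _⟩ ⟨0, Z'.zero_mem, map_zero _⟩
    have h2 := detSpan_reindex_map_prod (A := Algebra.adjoin k {theta k}) b c (wProd M N).symm e
      (P.integralW_prod Q) P.zero_mem_integralW Q.zero_mem_integralW
    -- Both sides factor by `detSpan_prod`, and the factors are matched by the coordinate forms `hb`
    -- and `hc` of the two given identities.
    exact h1.trans ((mul_eq_span_singleton_mul hb hc).trans (congrArg _ h2.symm))

end Conjecture

end SigmaModule

end TMotive

end

/-! ### The proposition -/

theorem mainTheorem2 {k : Type u} [Field k] [Fintype k]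
    (K : IntermediateField (TMotive.ratTheta k) (TMotive.Kinf k))
    [FiniteDimensional (TMotive.ratTheta k) K]
    (M₁ M₂ : TMotive.SigmaModule.{u, u, w} k K)
    (h₁ : M₁.IsEffective) (h₂ : M₂.IsEffective)
    (hf₁ : M₁.FiniteOverTau) (hf₂ : M₂.FiniteOverTau)
    (hu₁ : M₁.Uniformizable) (hu₂ : M₂.Uniformizable)
    (hg₁ : M₁.HasGoodReduction) (hg₂ : M₂.HasGoodReduction)
    (hc₁ : M₁.ConjectureHolds) (hc₂ : M₂.ConjectureHolds) :
    (M₁.prod M₂).IsEffective ∧ (M₁.prod M₂).FiniteOverTau ∧ (M₁.prod M₂).Uniformizable ∧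
      (M₁.prod M₂).HasGoodReduction ∧ (M₁.prod M₂).ConjectureHolds :=
  ⟨h₁.prod h₂, hf₁.prod hf₂, hu₁.prod hu₂, hg₁.prod hg₂, hc₁.prod hf₁ hf₂ hc₂⟩
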